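/- Let $\eta,\sigma:(0,\infty)\to(0,\infty)$ be bounded above and bounded below by positive constants, with $\sigma$ continuous, and $\eta$ strictly decreasing and differentiable with locally Lipschitz derivative (for instance $\eta\in C^2$). Let $S_0,V_0,K>0$. For $|\rho|<1$ put $$\mathcal I_\rho(S_0,V_0,K)=\inf_{g,h}\left\{\frac{1}{2(1-\rho^2)}\int_0^1\Big(\frac{g'(t)}{\eta(e^{g(t)})\sqrt{e^{h(t)}}}-\frac{\rho h'(t)}{\sigma(e^{h(t)})}\Big)^2dt+\frac12\int_0^1\Big(\frac{h'(t)}{\sigma(e^{h(t)})}\Big)^2dt\right\},$$ the infimum being over absolutely continuous $g,h$ on $[0,1]$ with $g(0)=\log S_0$, $h(0)=\log V_0$ and $\int_0^1e^{h(t)}\eta^2(e^{g(t)})\,dt=K$, and put $$\mathcal J(V_0,z)=\inf_{h(0)=\log V_0,\ \int_0^1e^{h(t)}dt=z}\frac12\int_0^1\Big(\frac{h'(t)}{\sigma(e^{h(t)})}\Big)^2dt$$ over absolutely continuous $h$ on $[0,1]$. Suppose $\rho=0$. (i) (Out-of-the-money call.) Suppose $V_0\eta^2(S_0)<K$. The equation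 $$\frac{\int_{S_0}^{G}\frac{dx}{x\eta(x)\sqrt{\eta^2(G)-\eta^2(x)}}}{\int_{S_0}^{G}\frac{\eta(x)\,dx}{x\sqrt{\eta^2(G)-\eta^2(x)}}}=\frac zK$$ has a solution $G\in(0,S_0)$ for which both integrals converge if and only if $K/\sup\eta^2<z<K/\eta^2(S_0)$. For each such $z$ there is a solution $G_c(z)$ which, among all solutions $G$ at $z$, minimizes $$\frac1{K^2}\Big(\int_{S_0}^{G}\frac{\eta(x)\,dx}{x\sqrt{2(\eta^2(G)-\eta^2(x))}}\Big)^2\big(\eta^2(G)z-K\big)$$ (in particular, $G_c(z)$ is the solution whenever it is unique), and $$\mathcal I_0(S_0,V_0,K)=\inf_{z}\left\{\frac1{K^2}\Big(\int_{S_0}^{G_c(z)}\frac{\eta(x)\,dx}{x\sqrt{2(\eta^2(G_c(z))-\eta^2(x))}}\Big)^2\big(\eta^2(G_c(z))z-K\big)+\mathcal J(V_0,z)\right\},$$ the infimum being over all $z\in(K/\sup\eta^2,\,K/\eta^2(S_0))$. (ii) (Out-of-the-money put.) Suppose $V_0\eta^2(S_0)>K$. The equation $$\frac{\int_{S_0}^{G}\frac{dx}{x\eta(x)\sqrt{\eta^2(x)-\eta^2(G)}}}{\int_{S_0}^{G}\frac{\eta(x)\,dx}{x\sqrt{\eta^2(x)-\eta^2(G)}}}=\frac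 zK$$ has a solution $G\in(S_0,\infty)$ for which both integrals converge if and only if $K/\eta^2(S_0)<z<K/\inf\eta^2$. For each such $z$ there is a solution $G_p(z)$ which, among all solutions $G$ at $z$, minimizes $$\frac1{K^2}\Big(\int_{S_0}^{G}\frac{\eta(x)\,dx}{x\sqrt{2(\eta^2(x)-\eta^2(G))}}\Big)^2\big(K-\eta^2(G)z\big),$$ and $$\mathcal I_0(S_0,V_0,K)=\inf_{z}\left\{\frac1{K^2}\Big(\int_{S_0}^{G_p(z)}\frac{\eta(x)\,dx}{x\sqrt{2(\eta^2(x)-\eta^2(G_p(z)))}}\Big)^2\big(K-\eta^2(G_p(z))z\big)+\mathcal J(V_0,z)\right\},$$ the infimum being over all $z\in(K/\eta^2(S_0),\,K/\inf\eta^2)$. -/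

import Mathlib

open MeasureTheory Set
open scoped ENNReal

noncomputable section

/-- The action of a pair of paths `(g, h)` (log-price, log-variance) on `[0,1]` for the
local-stochastic volatility model with local volatility `η`, volatility-of-volatility `σ` and
correlation `ρ`.  It takes the value `∞` when the integrals diverge. -/
def action (η σ : ℝ → ℝ) (ρ : ℝ) (g h : ℝ → ℝ) : ℝ≥0∞ :=
  ENNReal.ofReal (1 / (2 * (1 - ρ ^ 2))) *
      (∫⁻ t in Icc (0 : ℝ) 1, ENNReal.ofReal
        ((deriv g t / (η (Real.exp (g t)) * √(Real.exp (h t)))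
          - ρ * deriv h t / σ (Real.exp (h t))) ^ 2)) +
    ENNReal.ofReal (1 / 2) *
      (∫⁻ t in Icc (0 : ℝ) 1, ENNReal.ofReal ((deriv h t / σ (Real.exp (h t))) ^ 2))

/-- Admissible pairs of paths: absolutely continuous on `[0,1]`, started at
`(log S₀, log V₀)`, with integrated variance `∫₀¹ e^{h(t)} η²(e^{g(t)}) dt = K`. -/
structure AdmissiblePair (η : ℝ → ℝ) (S₀ V₀ K : ℝ) (g h : ℝ → ℝ) : Prop where
  ac_g : AbsolutelyContinuousOnInterval g 0 1
  ac_h : AbsolutelyContinuousOnInterval h 0 1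
  g_zero : g 0 = Real.log S₀
  h_zero : h 0 = Real.log V₀
  constraint : ∫ t in (0 : ℝ)..1, Real.exp (h t) * η (Real.exp (g t)) ^ 2 = K

/-- The rate function `I_ρ(S₀, V₀, K)`: the infimum of the action over admissible pairs. -/
def rateFunction (η σ : ℝ → ℝ) (ρ S₀ V₀ K : ℝ) : ℝ≥0∞ :=
  ⨅ (g : ℝ → ℝ) (h : ℝ → ℝ) (_ : AdmissiblePair η S₀ V₀ K g h), action η σ ρ g h

/-- Admissible paths for the Asian-option problem: absolutely continuous on `[0,1]`, started at
`log V₀`, with `∫₀¹ e^{h(t)} dt = z`. -/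
structure AdmissiblePath (V₀ z : ℝ) (h : ℝ → ℝ) : Prop where
  ac_h : AbsolutelyContinuousOnInterval h 0 1
  h_zero : h 0 = Real.log V₀
  constraint : ∫ t in (0 : ℝ)..1, Real.exp (h t) = z

/-- The Asian-option rate function `J(V₀, z)` of the volatility process. -/
def asianRate (σ : ℝ → ℝ) (V₀ z : ℝ) : ℝ≥0∞ :=
  ⨅ (h : ℝ → ℝ) (_ : AdmissiblePath V₀ z h),
    ENNReal.ofReal (1 / 2) *
      (∫⁻ t in Icc (0 : ℝ) 1, ENNReal.ofReal ((deriv h t / σ (Real.exp (h t))) ^ 2))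

/-- `G` solves the terminal-price equation of the call problem at `z`.  Both improper integrals
are required to converge, so that the quotient is a genuine quotient of integrals. -/
structure SolvesCall (η : ℝ → ℝ) (S₀ K z G : ℝ) : Prop where
  pos : 0 < G
  lt : G < S₀
  integrable_num : IntervalIntegrable
    (fun x => 1 / (x * η x * √(η G ^ 2 - η x ^ 2))) volume S₀ G
  integrable_den : IntervalIntegrable
    (fun x => η x / (x * √(η G ^ 2 - η x ^ 2))) volume S₀ G
  eq : (∫ x in S₀..G, 1 / (x * η x * √(η G ^ 2 - η x ^ 2))) /
      (∫ x in S₀..G, η x / (x * √(η G ^ 2 - η x ^ 2))) = z / K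

/-- `G` solves the terminal-price equation of the put problem at `z`. -/
structure SolvesPut (η : ℝ → ℝ) (S₀ K z G : ℝ) : Prop where
  lt : S₀ < G
  integrable_num : IntervalIntegrable
    (fun x => 1 / (x * η x * √(η x ^ 2 - η G ^ 2))) volume S₀ G
  integrable_den : IntervalIntegrable
    (fun x => η x / (x * √(η x ^ 2 - η G ^ 2))) volume S₀ G
  eq : (∫ x in S₀..G, 1 / (x * η x * √(η x ^ 2 - η G ^ 2))) /
      (∫ x in S₀..G, η x / (x * √(η x ^ 2 - η G ^ 2))) = z / K

/-- The asset-price contribution to the reduced objective for a call. -/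
def callTerm (η : ℝ → ℝ) (S₀ K z G : ℝ) : ℝ :=
  1 / K ^ 2 * (∫ x in S₀..G, η x / (x * √(2 * (η G ^ 2 - η x ^ 2)))) ^ 2 * (η G ^ 2 * z - K)

/-- The asset-price contribution to the reduced objective for a put. -/
def putTerm (η : ℝ → ℝ) (S₀ K z G : ℝ) : ℝ :=
  1 / K ^ 2 * (∫ x in S₀..G, η x / (x * √(2 * (η x ^ 2 - η G ^ 2)))) ^ 2 * (K - η G ^ 2 * z)

/-- The interval `(K / sup η², K / η²(S₀))`: the range of `z` in the call problem. -/
def callDomain (η : ℝ → ℝ) (S₀ K : ℝ) : Set ℝ :=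
  {z | (∃ x > 0, K / η x ^ 2 < z) ∧ z < K / η S₀ ^ 2}

/-- The interval `(K / η²(S₀), K / inf η²)`: the range of `z` in the put problem. -/
def putDomain (η : ℝ → ℝ) (S₀ K : ℝ) : Set ℝ :=
  {z | K / η S₀ ^ 2 < z ∧ ∃ x > 0, z < K / η x ^ 2}

end

open Filter Topology Asymptotics intervalIntegral

/-! For ρ = 0 the price and variance paths interact only through the clock s = ∫ e^h. Write the
price as S₀ e^(-εr), with ε = 1 for the call and ε = -1 for the put, and put f = ε η², c = 1/η, κ =
εK. In this clock, whose total duration is z = ∫₀¹ e^h, the price part of the action is ½∫₀^z (c(r)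
r')² ds under the constraint ∫₀^z f(r) ds = κ. Its minimum depends on h only through z, and
minimizing the rest over h at fixed z gives J.

Inner problem. Let A(a) = ∫₀^a c √(f(a) - f), T(a) = ∫₀^a c/√(f(a) - f) and B(a) = z f(a) - κ. For a
path with maximal level a, Young's inequality applied to μ c √(f(a) - f(r)) r' bounds the energy
below by μA - μ²B/2, hence by A²/(2B) (`Profile.le_pathEnergy`). Equality forces c r' = μ √(f(a) -
f(r)) with μ = A/B, and such a path reaches a at time z exactly when B T = z A. This is the equation
for G (`solves_iff_isExtremal`), and formally it is stationarity of A²/B, because dA/df(a) = T/2. A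
minimizing level exists since f is bounded (`exists_level_large`). Comparing it with levels just
below and just above gives the two halves of B T = z A, even though f' may vanish somewhere
(`intervalIntegrable_of_optimal`, `le_of_optimal`). So the least value of A²/(2B) is attained at a
solution G and realized by a path (`IsExtremal.exists_path`).

Outer problem. If z f(0) ≥ κ, then z lies outside the stated interval. Being out of the money means
V₀ f(0) < κ, so truncating h moves z towards V₀, to just inside the interval, without raising the
variance energy; there the price cost is arbitrarily small (`exists_truncation`,
`exists_small_value`). Such z therefore do not lower the infimum. -/

/-- A strictly increasing potential `f` together with a metric density `c`. -/
structure Profile (f c : ℝ → ℝ) : Prop where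
  mono : StrictMono f
  cont_f : Continuous f
  cont_c : Continuous c
  lower : ∃ m > 0, ∀ r, m ≤ c r
  bdd : BddAbove (range f)
  regular : ∀ a, (fun r => f r - f a) =O[𝓝 a] (fun r => (r - a) ^ 2) ∨
    (fun r => r - a) =O[𝓝 a] (fun r => f r - f a)

/-- The time needed to reach level `a` at unit Lagrange multiplier. -/
noncomputable def travelTime (f c : ℝ → ℝ) (a : ℝ) : ℝ := ∫ r in (0 : ℝ)..a, c r / √(f a - f r)

/-- The integral of the potential along the path reaching level `a`. -/
noncomputable def weightedTime (f c : ℝ → ℝ) (a : ℝ) : ℝ :=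
  ∫ r in (0 : ℝ)..a, c r * f r / √(f a - f r)

/-- The reduced cost of reaching level `a`. -/
noncomputable def travelCost (f c : ℝ → ℝ) (a : ℝ) : ℝ := ∫ r in (0 : ℝ)..a, c r * √(f a - f r)

/-- `a` is the terminal level of an extremal path of duration `z` and potential integral `κ`. -/
structure IsExtremal (f c : ℝ → ℝ) (z κ a : ℝ) : Prop where
  pos : 0 < a
  integrable : IntervalIntegrable (fun r => c r / √(f a - f r)) volume 0 a
  eq : travelTime f c a * κ = z * weightedTime f c a

/-! ### Increments of the travel cost. -/

/-- The square root is concave, so its graph lies below its tangent at X. The next lemma is the same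
bound to the right of X. -/
theorem sqrt_sub_sqrt_ge {X Y : ℝ} (hX : 0 < X) (hY : 0 ≤ Y) (h : Y ≤ X) :
    (X - Y) / 2 * (1 / √X) ≤ √X - √Y := by
  have h1 : 0 < √X := Real.sqrt_pos.2 hX
  have h2 : √Y ≤ √X := Real.sqrt_le_sqrt h
  have h3 : √X * √X = X := Real.mul_self_sqrt hX.le
  have h4 : √Y * √Y = Y := Real.mul_self_sqrt hY
  rw [mul_one_div, div_le_iff₀ h1]
  nlinarith [Real.sqrt_nonneg Y]

theorem sqrt_add_le_of_pos {X D : ℝ} (hX : 0 < X) (hD : 0 ≤ D) :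
    √(X + D) ≤ √X + D / 2 * (1 / √X) := by
  have h1 : 0 < √X := Real.sqrt_pos.2 hX
  apply Real.sqrt_le_iff.2
  refine ⟨by positivity, ?_⟩
  have h3 : √X ^ 2 = X := Real.sq_sqrt hX.le
  have h4 : √X * (1 / √X) = 1 := by field_simp
  nlinarith [sq_nonneg (D / 2 * (1 / √X))]

namespace Profile

variable {f c : ℝ → ℝ}

theorem c_pos (hp : Profile f c) (r : ℝ) : 0 < c r := by
  obtain ⟨m, hm, h⟩ := hp.lower
  exact hm.trans_le (h r)

theorem continuous_cost_integrand (hp : Profile f c) (v : ℝ) :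
    Continuous (fun r => c r * √(v - f r)) := by
  have := hp.cont_f
  have := hp.cont_c
  fun_prop

theorem continuousOn_time_integrand (hp : Profile f c) {v : ℝ} {s : Set ℝ}
    (hs : ∀ r ∈ s, f r < v) : ContinuousOn (fun r => c r / √(v - f r)) s := by
  apply hp.cont_c.continuousOn.div
  · have := hp.cont_f
    exact Continuous.continuousOn (by fun_prop)
  · intro r hr
    exact (Real.sqrt_pos.2 (sub_pos.2 (hs r hr))).ne'

theorem continuous_travelCost (hp : Profile f c) : Continuous (travelCost f c) := by
  unfold travelCost
  apply intervalIntegral.continuous_parametric_intervalIntegral_of_continuous _ continuous_id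
  have := hp.cont_f
  have := hp.cont_c
  simp only [Function.uncurry_def]
  fun_prop

theorem travelCost_pos (hp : Profile f c) {a : ℝ} (ha : 0 < a) : 0 < travelCost f c a := by
  apply intervalIntegral_pos_of_pos_on ((hp.continuous_cost_integrand _).intervalIntegrable _ _)
    _ ha
  intro r hr
  have := hp.mono hr.2
  exact mul_pos (hp.c_pos r) (Real.sqrt_pos.2 (by linarith))

theorem travelCost_nonneg (hp : Profile f c) {a : ℝ} (ha : 0 ≤ a) : 0 ≤ travelCost f c a :=
  integral_nonneg ha fun r _ => mul_nonneg (hp.c_pos r).le (Real.sqrt_nonneg _)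

theorem time_integrand_intervalIntegrable (hp : Profile f c) {y v : ℝ} (hy : 0 ≤ y)
    (hv : f y < v) : IntervalIntegrable (fun r => c r / √(v - f r)) volume 0 y := by
  apply ContinuousOn.intervalIntegrable
  apply hp.continuousOn_time_integrand
  intro r hr
  rw [uIcc_of_le hy] at hr
  exact (hp.mono.monotone hr.2).trans_lt hv

/-- Lower half of dA/df(a) = T/2, with increments of f in place of a derivative. Stopping the time
integral at y₀ makes the coefficient independent of y, so that y can tend to b before T(b) is known
to converge. -/
theorem travelCost_add_le (hp : Profile f c) {y₀ y b : ℝ} (hy₀ : 0 ≤ y₀) (hy : y₀ ≤ y)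
    (hb : y < b) : travelCost f c y
      + (f b - f y) / 2 * (∫ r in (0 : ℝ)..y₀, c r / √(f b - f r)) ≤ travelCost f c b := by
  have hy0 : 0 ≤ y := hy₀.trans hy
  have hlt := hp.mono hb
  have i1 := hp.time_integrand_intervalIntegrable hy0 hlt
  have s1 : (∫ r in (0 : ℝ)..y₀, c r / √(f b - f r)) ≤ ∫ r in (0 : ℝ)..y, c r / √(f b - f r) := by
    apply integral_mono_interval le_rfl hy₀ hy _ i1
    exact Eventually.of_forall fun r => div_nonneg (hp.c_pos r).le (Real.sqrt_nonneg _)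
  have s2 : (∫ r in (0 : ℝ)..y, c r * √(f b - f r)) ≤ travelCost f c b := by
    apply integral_mono_interval le_rfl hy0 hb.le _
      ((hp.continuous_cost_integrand _).intervalIntegrable _ _)
    exact Eventually.of_forall fun r => mul_nonneg (hp.c_pos r).le (Real.sqrt_nonneg _)
  have s3 : travelCost f c y + (f b - f y) / 2 * (∫ r in (0 : ℝ)..y, c r / √(f b - f r))
      ≤ ∫ r in (0 : ℝ)..y, c r * √(f b - f r) := by
    unfold travelCost
    rw [← intervalIntegral.integral_const_mul, ← intervalIntegral.integral_add
      ((hp.continuous_cost_integrand _).intervalIntegrable _ _) (i1.const_mul _)]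
    apply integral_mono_on hy0
      (((hp.continuous_cost_integrand _).intervalIntegrable _ _).add (i1.const_mul _))
      ((hp.continuous_cost_integrand _).intervalIntegrable _ _)
    intro r hr
    have h1 := hp.mono.monotone hr.2
    have := sqrt_sub_sqrt_ge (X := f b - f r) (Y := f y - f r) (by linarith) (by linarith)
      (by linarith)
    have e : f b - f r - (f y - f r) = f b - f y := by ring
    rw [e] at this
    have := mul_le_mul_of_nonneg_left this (hp.c_pos r).le
    calc _ = c r * √(f y - f r) + c r * ((f b - f y) / 2 * (1 / √(f b - f r))) := by ring
      _ ≤ _ := by linarith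
  have := mul_le_mul_of_nonneg_left s1 (by linarith : 0 ≤ (f b - f y) / 2)
  linarith

/-- Upper half of dA/df(a) = T/2. The last term bounds the contribution of the new piece [a, y]. -/
theorem travelCost_le_add (hp : Profile f c) {a y C : ℝ} (ha : 0 < a)
    (hi : IntervalIntegrable (fun r => c r / √(f a - f r)) volume 0 a)
    (hy : a < y) (hC : ∀ r ∈ Icc a y, c r ≤ C) : travelCost f c y ≤ travelCost f c a
      + (f y - f a) / 2 * travelTime f c a + (y - a) * C * √(f y - f a) := by
  have hlt := hp.mono hy
  have ic := fun v p q => (hp.continuous_cost_integrand v).intervalIntegrable (μ := volume) p q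
  have e : travelCost f c y = (∫ r in (0 : ℝ)..a, c r * √(f y - f r))
      + ∫ r in a..y, c r * √(f y - f r) :=
    (integral_add_adjacent_intervals (ic _ _ _) (ic _ _ _)).symm
  have s1 : (∫ r in (0 : ℝ)..a, c r * √(f y - f r)) ≤ travelCost f c a
      + (f y - f a) / 2 * travelTime f c a := by
    unfold travelCost travelTime
    rw [← intervalIntegral.integral_const_mul, ← intervalIntegral.integral_add
      (ic _ _ _) (hi.const_mul _)]
    apply integral_mono_on_of_le_Ioo ha.le (ic _ _ _) ((ic _ _ _).add (hi.const_mul _))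
    intro r hr
    have h1 := hp.mono hr.2
    have := sqrt_add_le_of_pos (X := f a - f r) (D := f y - f a) (by linarith) (by linarith)
    have e : f a - f r + (f y - f a) = f y - f r := by ring
    rw [e] at this
    have := mul_le_mul_of_nonneg_left this (hp.c_pos r).le
    calc _ ≤ _ := this
      _ = _ := by ring
  have s2 : (∫ r in a..y, c r * √(f y - f r)) ≤ ∫ r in a..y, C * √(f y - f a) := by
    apply integral_mono_on hy.le (ic _ _ _) (by simp)
    intro r hr
    have h1 := hp.mono.monotone hr.1
    have h2 := hC r hr
    have := (hp.c_pos r).le.trans h2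
    gcongr
  rw [intervalIntegral.integral_const, smul_eq_mul] at s2
  linarith

theorem weighted_intervalIntegrable (hp : Profile f c) {a v : ℝ}
    (hi : IntervalIntegrable (fun r => c r / √(v - f r)) volume 0 a) :
    IntervalIntegrable (fun r => c r * f r / √(v - f r)) volume 0 a := by
  have := hi.continuousOn_mul (hp.cont_f.continuousOn (s := uIcc 0 a))
  exact this.congr (fun r _ => by ring)

/-- Comes from X/√X = √X with X = f(a) - f(r), an identity that also holds at X = 0 under the
convention for division by zero. -/
theorem travelCost_eq (hp : Profile f c) {a : ℝ}
    (hi : IntervalIntegrable (fun r => c r / √(f a - f r)) volume 0 a) :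
    travelCost f c a = f a * travelTime f c a - weightedTime f c a := by
  unfold travelCost travelTime weightedTime
  rw [← intervalIntegral.integral_const_mul, ← intervalIntegral.integral_sub
      (hi.const_mul _) (hp.weighted_intervalIntegrable hi)]
  congr 1
  ext r
  linear_combination (-c r) * Real.div_sqrt (x := f a - f r)

theorem travelTime_pos (hp : Profile f c) {a : ℝ} (ha : 0 < a)
    (hi : IntervalIntegrable (fun r => c r / √(f a - f r)) volume 0 a) :
    0 < travelTime f c a := by
  apply intervalIntegral_pos_of_pos_on hi _ ha
  intro r hr
  have := hp.mono hr.2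
  exact div_pos (hp.c_pos r) (Real.sqrt_pos.2 (by linarith))

theorem mul_travelTime_lt_weightedTime (hp : Profile f c) {a : ℝ} (ha : 0 < a)
    (hi : IntervalIntegrable (fun r => c r / √(f a - f r)) volume 0 a) :
    f 0 * travelTime f c a < weightedTime f c a := by
  rw [← sub_pos]
  unfold travelTime weightedTime
  rw [← intervalIntegral.integral_const_mul, ← intervalIntegral.integral_sub
      (hp.weighted_intervalIntegrable hi) (hi.const_mul _)]
  apply intervalIntegral_pos_of_pos_on
    ((hp.weighted_intervalIntegrable hi).sub (hi.const_mul _)) _ ha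
  intro r hr
  have h1 := hp.mono hr.2
  have h2 := hp.mono hr.1
  have : 0 < (f r - f 0) * (c r / √(f a - f r)) :=
    mul_pos (by linarith) (div_pos (hp.c_pos r) (Real.sqrt_pos.2 (by linarith)))
  calc 0 < _ := this
    _ = _ := by ring

end Profile

/-! ### The extremal equation. -/

namespace IsExtremal

variable {f c : ℝ → ℝ} {z κ a : ℝ}

/-- The stationarity form B T = z A of the extremal equation, obtained by eliminating the weighted
time. -/
theorem excess_mul (h : IsExtremal f c z κ a) (hp : Profile f c) :
    (z * f a - κ) * travelTime f c a = z * travelCost f c a := by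
  rw [hp.travelCost_eq h.integrable]
  linear_combination -h.eq

theorem lt_mul (h : IsExtremal f c z κ a) (hp : Profile f c) (hz : 0 < z) : κ < z * f a := by
  have h1 := h.excess_mul hp
  have h2 := mul_pos hz (hp.travelCost_pos h.pos)
  rw [← h1] at h2
  have := (mul_pos_iff_of_pos_right (hp.travelTime_pos h.pos h.integrable)).1 h2
  linarith

theorem mul_lt (h : IsExtremal f c z κ a) (hp : Profile f c) (hz : 0 < z) : z * f 0 < κ := by
  have h1 := h.eq
  have h2 := mul_lt_mul_of_pos_left (hp.mul_travelTime_lt_weightedTime h.pos h.integrable) hz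
  rw [← h1] at h2
  have := hp.travelTime_pos h.pos h.integrable
  nlinarith

/-- The value of the reduced problem at an extremal. -/
theorem value_eq (h : IsExtremal f c z κ a) (hp : Profile f c) (hz : 0 < z) (hκ : κ ≠ 0) :
    1 / κ ^ 2 * (weightedTime f c a) ^ 2 / 2 * (z * f a - κ)
      = travelCost f c a ^ 2 / (2 * (z * f a - κ)) := by
  have hB := sub_pos.2 (h.lt_mul hp hz)
  have e1 := h.excess_mul hp
  have e2 := h.eq
  have a1 : travelCost f c a = (z * f a - κ) * travelTime f c a / z := by
    field_simp; linarith
  have a2 : weightedTime f c a = travelTime f c a * κ / z := by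
    field_simp; linarith
  rw [a1, a2]
  field_simp

end IsExtremal

/-! ### Minimizing A²/B over levels. -/

namespace Profile

variable {f c : ℝ → ℝ} {z κ : ℝ}

/-- Past Y the quotient B/A² never exceeds its value at Y. With M = sup f and J = ∫₀^Y c/√(M - f),
large Y satisfies z A(Y) ≤ B(Y) J. The concavity bound gives A(y)² ≥ A(Y)² + A(Y) (f(y) - f(Y)) J,
which outweighs the growth z (f(y) - f(Y)) of B. -/
theorem exists_level_large (hp : Profile f c) (hz : 0 < z) {b : ℝ} (hb0 : 0 ≤ b)
    (hb : κ < z * f b) :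
    ∃ Y ≥ b, 0 < Y ∧ ∀ y > Y,
      (z * f y - κ) * travelCost f c Y ^ 2 ≤ (z * f Y - κ) * travelCost f c y ^ 2 := by
  set M := ⨆ r, f r with hM
  have hlt : ∀ r, f r < M := fun r =>
    (hp.mono (lt_add_one r)).trans_le (le_ciSup hp.bdd (r + 1))
  have hlim : Tendsto f atTop (𝓝 M) := tendsto_atTop_ciSup hp.mono.monotone hp.bdd
  obtain ⟨m, hm, hcm⟩ := hp.lower
  set ε := (z * f b - κ) / 2 with hε
  have hε0 : 0 < ε := by rw [hε]; linarith
  have hev : ∀ᶠ Y in atTop, z * (M - f Y) < ε := by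
    have : Tendsto (fun Y => z * (M - f Y)) atTop (𝓝 (z * (M - M))) :=
      (hlim.const_sub M).const_mul z
    rw [sub_self, mul_zero] at this
    exact this.eventually_lt_const hε0
  have ii : ∀ {y : ℝ}, 0 ≤ y → ∀ (q : ℝ → ℝ), Continuous q → ∀ x ∈ Icc 0 y,
      IntervalIntegrable (fun r => c r / √(M - f r) * q r) volume x y := by
    intro y hy q hq x hx
    apply ContinuousOn.intervalIntegrable
    exact (hp.continuousOn_time_integrand fun r _ => hlt r).mul hq.continuousOn
  set D := ∫ r in (0 : ℝ)..b, c r / √(M - f r) * (z * f b - κ - z * (M - f r)) with hD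
  set s := √(M - f b) with hs
  have hs0 : 0 < s := Real.sqrt_pos.2 (sub_pos.2 (hlt b))
  obtain ⟨Y, hY1, hY2⟩ := (hev.and (eventually_ge_atTop (b + |D| * s / (ε * m) + 1))).exists
  have hYb : b < Y := by
    have : 0 ≤ |D| * s / (ε * m) := by positivity
    linarith
  have hY0 : 0 < Y := hb0.trans_lt hYb
  have hfb := hp.mono hYb
  refine ⟨Y, hYb.le, hY0, ?_⟩
  have cf := hp.cont_f
  have hG : 0 ≤ ∫ r in (0 : ℝ)..Y, c r / √(M - f r) * (z * f Y - κ - z * (M - f r)) := by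
    have ib : IntervalIntegrable
        (fun r => c r / √(M - f r) * (z * f Y - κ - z * (M - f r))) volume 0 b :=
      ii hb0 _ (by fun_prop) _ ⟨le_rfl, hb0⟩
    rw [← integral_add_adjacent_intervals ib (ii hY0.le _ (by fun_prop) _ ⟨hb0, hYb.le⟩)]
    have t1 : D ≤ ∫ r in (0 : ℝ)..b, c r / √(M - f r) * (z * f Y - κ - z * (M - f r)) := by
      apply integral_mono_on hb0 (ii hb0 _ (by fun_prop) _ ⟨le_rfl, hb0⟩) ib
      intro r _
      have h1 : 0 ≤ c r / √(M - f r) := div_nonneg (hp.c_pos r).le (Real.sqrt_nonneg _)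
      have h2 : z * f b ≤ z * f Y := by gcongr
      gcongr
    have t2 : ∫ r in b..Y, m / s * ε ≤
        ∫ r in b..Y, c r / √(M - f r) * (z * f Y - κ - z * (M - f r)) := by
      apply integral_mono_on hYb.le (by simp) (ii hY0.le _ (by fun_prop) _ ⟨hb0, hYb.le⟩)
      intro r hr
      have h1 : f b ≤ f r := hp.mono.monotone hr.1
      have h2 : √(M - f r) ≤ s := Real.sqrt_le_sqrt (by linarith)
      have h3 : 0 < √(M - f r) := Real.sqrt_pos.2 (sub_pos.2 (hlt r))
      have h4 : ε ≤ z * f Y - κ - z * (M - f r) := by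
        have : z * f b ≤ z * f r := by gcongr
        linarith
      have := hcm r
      have := (hp.c_pos r).le
      gcongr
    rw [intervalIntegral.integral_const, smul_eq_mul] at t2
    have t3 : |D| ≤ (Y - b) * (m / s * ε) := by
      have : |D| * s / (ε * m) ≤ Y - b := by linarith
      rw [div_le_iff₀ (by positivity)] at this
      calc |D| = |D| * s / s := by field_simp
        _ ≤ (Y - b) * (ε * m) / s := by gcongr
        _ = _ := by ring
    linarith [neg_abs_le D]
  -- Rewrites `hG` as z ∫₀^Y c √(M - f) ≤ B(Y) J; the left side dominates z A(Y) because M ≥ f(Y).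
  have hsplit : (∫ r in (0 : ℝ)..Y, c r / √(M - f r) * (z * f Y - κ - z * (M - f r)))
      = (z * f Y - κ) * (∫ r in (0 : ℝ)..Y, c r / √(M - f r))
        - z * ∫ r in (0 : ℝ)..Y, c r * √(M - f r) := by
    have i0 : IntervalIntegrable (fun r => c r / √(M - f r)) volume 0 Y := by
      simpa using ii hY0.le (fun _ => 1) continuous_const 0 ⟨le_rfl, hY0.le⟩
    rw [← intervalIntegral.integral_const_mul, ← intervalIntegral.integral_const_mul,
      ← intervalIntegral.integral_sub (i0.const_mul _)
        (((hp.continuous_cost_integrand M).intervalIntegrable _ _).const_mul _)]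
    congr 1
    ext r
    linear_combination (-z * c r) * Real.div_sqrt (x := M - f r)
  rw [hsplit] at hG
  have hA : travelCost f c Y ≤ ∫ r in (0 : ℝ)..Y, c r * √(M - f r) := by
    apply integral_mono_on hY0.le ((hp.continuous_cost_integrand _).intervalIntegrable _ _)
      ((hp.continuous_cost_integrand _).intervalIntegrable _ _)
    intro r _
    have := (hp.c_pos r).le
    have := (hlt Y).le
    gcongr
  intro y hy
  have hfy := hp.mono hy
  have g1 := hp.travelCost_add_le hY0.le le_rfl hy
  have hJ : (∫ r in (0 : ℝ)..Y, c r / √(M - f r)) ≤ ∫ r in (0 : ℝ)..Y, c r / √(f y - f r) := by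
    have i0 : IntervalIntegrable (fun r => c r / √(M - f r)) volume 0 Y := by
      simpa using ii hY0.le (fun _ => 1) continuous_const 0 ⟨le_rfl, hY0.le⟩
    apply integral_mono_on hY0.le i0 (hp.time_integrand_intervalIntegrable hY0.le hfy)
    intro r hr
    have h1 : 0 < √(f y - f r) :=
      Real.sqrt_pos.2 (sub_pos.2 ((hp.mono.monotone hr.2).trans_lt hfy))
    have := (hp.c_pos r).le
    have := (hlt y).le
    gcongr
  set J := ∫ r in (0 : ℝ)..Y, c r / √(M - f r)
  set J' := ∫ r in (0 : ℝ)..Y, c r / √(f y - f r)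
  set AM := ∫ r in (0 : ℝ)..Y, c r * √(M - f r)
  set A := travelCost f c Y
  set A' := travelCost f c y
  have hA0 : 0 < A := hp.travelCost_pos hY0
  have hB : 0 < z * f Y - κ := by
    have : z * f b ≤ z * f Y := by gcongr
    linarith
  have hJ0 : 0 ≤ J := integral_nonneg hY0.le fun r _ =>
    div_nonneg (hp.c_pos r).le (Real.sqrt_nonneg _)
  have k1 : z * A ≤ (z * f Y - κ) * J := by
    have : z * A ≤ z * AM := by gcongr
    linarith
  have k2 : A + (f y - f Y) / 2 * J ≤ A' := by
    have : (f y - f Y) / 2 * J ≤ (f y - f Y) / 2 * J' :=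
      mul_le_mul_of_nonneg_left hJ (by linarith)
    linarith
  have k3 : A ^ 2 + A * (f y - f Y) * J ≤ A' ^ 2 := by
    have : 0 ≤ (f y - f Y) / 2 * J := mul_nonneg (by linarith) hJ0
    have : (A + (f y - f Y) / 2 * J) ^ 2 ≤ A' ^ 2 := by gcongr
    nlinarith [sq_nonneg ((f y - f Y) / 2 * J)]
  have k4 := mul_le_mul_of_nonneg_left k1 (mul_nonneg hA0.le (sub_pos.2 hfy).le)
  have k5 := mul_le_mul_of_nonneg_left k3 hB.le
  nlinarith

/-- B/A² is maximized on a compact interval [p, Y]. The cross-multiplied form of optimality makes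
sense for levels with B ≤ 0 too. -/
theorem exists_optimal_level (hp : Profile f c) (hz : 0 < z) (h0 : z * f 0 < κ)
    {b : ℝ} (hb : κ < z * f b) :
    ∃ a > 0, κ < z * f a ∧ ∀ y > 0,
      (z * f y - κ) * travelCost f c a ^ 2 ≤ (z * f a - κ) * travelCost f c y ^ 2 := by
  have hb0 : 0 < b := by
    have : f 0 < f b := lt_of_mul_lt_mul_left (h0.trans hb) hz.le
    exact hp.mono.lt_iff_lt.1 this
  obtain ⟨Y, hYb, hY0, hY⟩ := hp.exists_level_large hz hb0.le hb
  have hBY : 0 < z * f Y - κ := by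
    have : z * f b ≤ z * f Y := mul_le_mul_of_nonneg_left (hp.mono.monotone hYb) hz.le
    linarith
  -- Levels below this zero of B have B ≤ 0 and cannot compete; above it A stays away from 0.
  obtain ⟨p, hp0, hpκ⟩ : ∃ p ∈ Ioo 0 Y, z * f p = κ := by
    have := intermediate_value_Ioo hY0.le
      (f := fun r => z * f r) (hp.cont_f.const_mul z).continuousOn
    exact this ⟨h0, by linarith⟩
  have cc : ContinuousOn (fun y => (z * f y - κ) / travelCost f c y ^ 2) (Icc p Y) := by
    have := hp.cont_f
    apply ContinuousOn.div (by fun_prop) (hp.continuous_travelCost.pow 2).continuousOn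
    intro y hy
    exact (pow_pos (hp.travelCost_pos (hp0.1.trans_le hy.1)) 2).ne'
  obtain ⟨a, ha, hmax⟩ := isCompact_Icc.exists_isMaxOn ⟨Y, hp0.2.le, le_rfl⟩ cc
  have ha0 : 0 < a := hp0.1.trans_le ha.1
  have pA := pow_pos (hp.travelCost_pos ha0) 2
  have pY := pow_pos (hp.travelCost_pos hY0) 2
  have hle : ∀ y ∈ Icc p Y,
      (z * f y - κ) * travelCost f c a ^ 2 ≤ (z * f a - κ) * travelCost f c y ^ 2 := by
    intro y hy
    have := hmax hy
    rwa [mem_ofPred_eq, div_le_div_iff₀ (pow_pos (hp.travelCost_pos (hp0.1.trans_le hy.1)) 2) pA]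
      at this
  have hBa : 0 < z * f a - κ := by
    have := hle Y ⟨hp0.2.le, le_rfl⟩
    have h2 := (mul_pos hBY pA).trans_le this
    exact (mul_pos_iff_of_pos_right pY).1 h2
  refine ⟨a, ha0, by linarith, fun y hy => ?_⟩
  rcases lt_or_ge y p with h | h
  · have : z * f y ≤ z * f p := mul_le_mul_of_nonneg_left (hp.mono.monotone h.le) hz.le
    have h1 : (z * f y - κ) * travelCost f c a ^ 2 ≤ 0 :=
      mul_nonpos_of_nonpos_of_nonneg (by linarith) pA.le
    exact h1.trans (by positivity)
  rcases le_or_gt y Y with h' | h'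
  · exact hle y ⟨h, h'⟩
  · have h1 := hY y h'
    have h2 := hle Y ⟨hp0.2.le, le_rfl⟩
    have py := pow_pos (hp.travelCost_pos hy) 2
    rw [← div_le_div_iff₀ py pY] at h1
    rw [← div_le_div_iff₀ pY pA] at h2
    rw [← div_le_div_iff₀ py pA]
    exact h1.trans h2

/-- Comparison with levels y increasing to a gives B ∫₀^y₀ c/√(f(a) - f) ≤ z A for every y₀ < a.
This uniform bound yields both convergence of T(a) and one half of stationarity. -/
theorem intervalIntegrable_of_optimal (hp : Profile f c) {a : ℝ} (ha : 0 < a)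
    (hB : κ < z * f a) (hopt : ∀ y > 0,
      (z * f y - κ) * travelCost f c a ^ 2 ≤ (z * f a - κ) * travelCost f c y ^ 2) :
    IntervalIntegrable (fun r => c r / √(f a - f r)) volume 0 a ∧
      (z * f a - κ) * travelTime f c a ≤ z * travelCost f c a := by
  set A := travelCost f c a with hA
  set B := z * f a - κ with hBdef
  have hA0 : 0 < A := hp.travelCost_pos ha
  have hB0 : 0 < B := sub_pos.2 hB
  have key : ∀ y₀ ∈ Ioo 0 a, B * (∫ r in (0 : ℝ)..y₀, c r / √(f a - f r)) ≤ z * A := by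
    intro y₀ hy₀
    set J := ∫ r in (0 : ℝ)..y₀, c r / √(f a - f r) with hJ
    have hJ0 : 0 ≤ J := integral_nonneg hy₀.1.le fun r _ =>
      div_nonneg (hp.c_pos r).le (Real.sqrt_nonneg _)
    -- The optimality inequality at y after division by f(a) - f(y) > 0.
    have hb : ∀ᶠ y in 𝓝[<] a, A * B * J ≤ z * A ^ 2 + B * (f a - f y) * (J / 2) ^ 2 := by
      filter_upwards [Ioo_mem_nhdsLT hy₀.2] with y hy
      have h1 := hp.travelCost_add_le hy₀.1.le hy.1.le hy.2
      have hlt := hp.mono hy.2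
      have h2 := hopt y (hy₀.1.trans hy.1)
      have h3 : travelCost f c y ≤ A - (f a - f y) * (J / 2) := by
        rw [← hJ] at h1; linarith
      have h4 : travelCost f c y ^ 2 ≤ (A - (f a - f y) * (J / 2)) ^ 2 := by
        have := hp.travelCost_nonneg (hy₀.1.trans hy.1).le
        gcongr
      have h5 := h2.trans (mul_le_mul_of_nonneg_left h4 hB0.le)
      have h6 : z * f y - κ = B - z * (f a - f y) := by rw [hBdef]; ring
      rw [h6] at h5
      have hd : 0 < f a - f y := sub_pos.2 hlt
      nlinarith
    have hl : Tendsto (fun y => z * A ^ 2 + B * (f a - f y) * (J / 2) ^ 2) (𝓝[<] a)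
        (𝓝 (z * A ^ 2 + B * (f a - f a) * (J / 2) ^ 2)) := by
      have cf := hp.cont_f
      exact ((by fun_prop : Continuous
        fun y => z * A ^ 2 + B * (f a - f y) * (J / 2) ^ 2).tendsto a).mono_left nhdsWithin_le_nhds
    have := ge_of_tendsto hl hb
    nlinarith
  have hseq : ∃ u : ℕ → ℝ, (∀ n, u n ∈ Ioo 0 a) ∧ Tendsto u atTop (𝓝 a) := by
    obtain ⟨u, -, hu, hl⟩ := exists_seq_strictMono_tendsto' ha
    exact ⟨u, hu, hl⟩
  obtain ⟨u, hu, hul⟩ := hseq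
  have hint : IntegrableOn (fun r => c r / √(f a - f r)) (Ioc 0 a) := by
    apply integrableOn_Ioc_of_intervalIntegral_norm_bounded (I := z * A / B) (l := atTop)
      (a := fun _ => (0 : ℝ)) (b := u) _ tendsto_const_nhds hul
    · refine Eventually.of_forall fun n => ?_
      have e : (∫ r in Ioc 0 (u n), ‖c r / √(f a - f r)‖) =
          ∫ r in (0 : ℝ)..u n, c r / √(f a - f r) := by
        rw [integral_of_le (hu n).1.le]
        congr 1
        ext r
        exact Real.norm_of_nonneg (div_nonneg (hp.c_pos r).le (Real.sqrt_nonneg _))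
      rw [e, le_div_iff₀' hB0]
      exact key _ (hu n)
    · intro n
      have := hp.time_integrand_intervalIntegrable (hu n).1.le (hp.mono (hu n).2)
      exact (intervalIntegrable_iff_integrableOn_Ioc_of_le (hu n).1.le).1 this
  have hint' : IntervalIntegrable (fun r => c r / √(f a - f r)) volume 0 a :=
    (intervalIntegrable_iff_integrableOn_Ioc_of_le ha.le).2 hint
  refine ⟨hint', ?_⟩
  have hcont : ContinuousOn (fun y => ∫ r in (0 : ℝ)..y, c r / √(f a - f r)) (uIcc 0 a) :=
    continuousOn_primitive_interval ((intervalIntegrable_iff' (by simp)).1 hint')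
  have hl : Tendsto (fun n => B * ∫ r in (0 : ℝ)..u n, c r / √(f a - f r)) atTop
      (𝓝 (B * travelTime f c a)) := by
    apply Tendsto.const_mul
    have := hcont a right_mem_uIcc
    refine this.tendsto.comp (tendsto_nhdsWithin_iff.2 ⟨hul, Eventually.of_forall fun n => ?_⟩)
    rw [uIcc_of_le ha.le]
    exact Ioo_subset_Icc_self (hu n)
  exact le_of_tendsto hl (Eventually.of_forall fun n => key _ (hu n))

/-- If f - f(a) were quadratically small, c/√|f(a) - f| would dominate a multiple of 1/|r - a| and
the time would diverge. Only the other alternative of `regular` remains. -/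
theorem sub_isBigO_of_intervalIntegrable (hp : Profile f c) {a : ℝ} (ha : 0 < a)
    (hi : IntervalIntegrable (fun r => c r / √(f a - f r)) volume 0 a) :
    (fun r => r - a) =O[𝓝 a] (fun r => f r - f a) := by
  refine (hp.regular a).resolve_left fun hO => ?_
  obtain ⟨m, hm, hcm⟩ := hp.lower
  -- The absolute value changes nothing on [0, a] and lets the comparison hold on both sides of a.
  have habs : IntervalIntegrable (fun r => c r / √|f a - f r|) volume 0 a := by
    refine hi.congr (fun r hr => ?_)
    rw [uIoc_of_le ha.le] at hr
    rw [abs_of_nonneg (sub_nonneg.2 (hp.mono.monotone hr.2))]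
  refine not_intervalIntegrable_of_sub_inv_isBigO_punctured (c := a) ?_ ha.ne
    right_mem_uIcc habs
  obtain ⟨L, hL0, hL⟩ := hO.exists_pos
  have hL' := hL.bound.filter_mono (nhdsWithin_le_nhds (s := {a}ᶜ))
  apply IsBigO.of_bound (√L / m)
  filter_upwards [hL', self_mem_nhdsWithin] with r hr hne
  have hne' : r ≠ a := hne
  have h1 : 0 < |r - a| := abs_pos.2 (sub_ne_zero.2 hne')
  have h2 : 0 < |f a - f r| := abs_pos.2 (sub_ne_zero.2 (hp.mono.injective.ne hne'.symm))
  have h3 : √|f a - f r| ≤ √L * |r - a| := by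
    rw [Real.norm_eq_abs, Real.norm_eq_abs, abs_sub_comm, abs_pow] at hr
    calc √|f a - f r| ≤ √(L * |r - a| ^ 2) := Real.sqrt_le_sqrt hr
      _ = _ := by rw [Real.sqrt_mul hL0.le, Real.sqrt_sq h1.le]
  have h4 : 0 < √|f a - f r| := Real.sqrt_pos.2 h2
  rw [norm_inv, Real.norm_eq_abs, Real.norm_of_nonneg (div_nonneg (hp.c_pos r).le h4.le)]
  have hsL : 0 < √L := Real.sqrt_pos.2 hL0
  calc |r - a|⁻¹ = √L / m * (m / (√L * |r - a|)) := by field_simp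
    _ ≤ √L / m * (c r / √|f a - f r|) := by
      have := hcm r
      have := (hp.c_pos r).le
      gcongr

/-- Comparison with levels y decreasing to a. Since y - a = O(f(y) - f(a)), the new piece [a, y]
costs O((f(y) - f(a))^(3/2)), which vanishes after division by f(y) - f(a). -/
theorem le_of_optimal (hp : Profile f c) {a : ℝ} (ha : 0 < a)
    (hB : κ < z * f a) (hopt : ∀ y > 0,
      (z * f y - κ) * travelCost f c a ^ 2 ≤ (z * f a - κ) * travelCost f c y ^ 2)
    (hi : IntervalIntegrable (fun r => c r / √(f a - f r)) volume 0 a) :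
    z * travelCost f c a ≤ (z * f a - κ) * travelTime f c a := by
  set A := travelCost f c a with hA
  set B := z * f a - κ with hBdef
  set T := travelTime f c a with hT
  have hA0 : 0 < A := hp.travelCost_pos ha
  have hB0 : 0 < B := sub_pos.2 hB
  obtain ⟨k, hk0, hk⟩ := (hp.sub_isBigO_of_intervalIntegrable ha hi).exists_pos
  obtain ⟨C, hC⟩ := (isCompact_Icc (a := a) (b := a + 1)).exists_bound_of_continuousOn
    hp.cont_c.continuousOn
  have hC0 : 0 ≤ C := (norm_nonneg _).trans (hC a ⟨le_rfl, by linarith⟩)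
  have hb : ∀ᶠ y in 𝓝[>] a, z * A ^ 2 ≤ 2 * A * B * (T / 2 + k * C * √(f y - f a))
      + B * (f y - f a) * (T / 2 + k * C * √(f y - f a)) ^ 2 := by
    filter_upwards [Ioo_mem_nhdsGT (lt_add_one a), hk.bound.filter_mono nhdsWithin_le_nhds]
      with y hy hky
    have hlt := hp.mono hy.1
    have hd : 0 < f y - f a := sub_pos.2 hlt
    rw [Real.norm_of_nonneg (by linarith [hy.1]), Real.norm_of_nonneg hd.le] at hky
    have h1 := hp.travelCost_le_add ha hi hy.1 (C := C) fun r hr =>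
      (le_abs_self _).trans (hC r ⟨hr.1, hr.2.trans hy.2.le⟩)
    have h2 : (y - a) * C * √(f y - f a) ≤ k * (f y - f a) * C * √(f y - f a) := by gcongr
    have h3 : travelCost f c y ≤ A + (f y - f a) * (T / 2 + k * C * √(f y - f a)) := by
      linarith
    have hy0 := hp.travelCost_pos (ha.trans hy.1)
    have h4 : travelCost f c y ^ 2 ≤ (A + (f y - f a) * (T / 2 + k * C * √(f y - f a))) ^ 2 := by
      gcongr
    have h5 := (hopt y (ha.trans hy.1)).trans (mul_le_mul_of_nonneg_left h4 hB0.le)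
    have h6 : z * f y - κ = B + z * (f y - f a) := by rw [hBdef]; ring
    rw [h6] at h5
    set q := T / 2 + k * C * √(f y - f a)
    refine le_of_mul_le_mul_left ?_ hd
    linarith
  have cf := hp.cont_f
  have hl := ((by fun_prop : Continuous fun y =>
    2 * A * B * (T / 2 + k * C * √(f y - f a))
      + B * (f y - f a) * (T / 2 + k * C * √(f y - f a)) ^ 2).tendsto a).mono_left
        (nhdsWithin_le_nhds (s := Ioi a))
  have := ge_of_tendsto hl hb
  simp only [sub_self, Real.sqrt_zero, mul_zero, add_zero, zero_mul] at this
  nlinarith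

theorem exists_isExtremal (hp : Profile f c) (hz : 0 < z) (h0 : z * f 0 < κ)
    {b : ℝ} (hb : κ < z * f b) :
    ∃ a, IsExtremal f c z κ a ∧ ∀ y > 0, κ < z * f y →
      travelCost f c a ^ 2 / (2 * (z * f a - κ)) ≤ travelCost f c y ^ 2 / (2 * (z * f y - κ)) := by
  obtain ⟨a, ha, hB, hopt⟩ := hp.exists_optimal_level hz h0 hb
  obtain ⟨hi, h1⟩ := hp.intervalIntegrable_of_optimal ha hB hopt
  have h2 := hp.le_of_optimal ha hB hopt hi
  refine ⟨a, ⟨ha, hi, ?_⟩, fun y hy hκ => ?_⟩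
  · have e := hp.travelCost_eq hi
    rw [e] at h1 h2
    linarith
  · rw [div_le_div_iff₀ (by linarith) (by linarith)]
    linarith [hopt y hy]

end Profile

/-! ### Lower bound for the energy of a path. -/

theorem AbsolutelyContinuousOnInterval.lipschitzOnWith_comp {φ g : ℝ → ℝ} {a b : ℝ} {L : NNReal}
    {s : Set ℝ} (hg : AbsolutelyContinuousOnInterval g a b) (hφ : LipschitzOnWith L φ s)
    (hs : MapsTo g (uIcc a b) s) :
    AbsolutelyContinuousOnInterval (fun t => φ (g t)) a b := by
  rw [absolutelyContinuousOnInterval_iff] at hg ⊢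
  intro ε hε
  obtain ⟨δ, hδ, H⟩ := hg (ε / (L + 1)) (by positivity)
  refine ⟨δ, hδ, fun E hE hlt => ?_⟩
  have h1 := H E hE hlt
  have hE' := hE.1
  calc _ ≤ ∑ i ∈ Finset.range E.1, L * dist (g (E.2 i).1) (g (E.2 i).2) := by
        apply Finset.sum_le_sum
        intro i hi
        exact hφ.dist_le_mul _ (hs (hE' i hi).1) _ (hs (hE' i hi).2)
    _ = L * ∑ i ∈ Finset.range E.1, dist (g (E.2 i).1) (g (E.2 i).2) := by
        rw [Finset.mul_sum]
    _ ≤ L * (ε / (L + 1)) := by gcongr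
    _ < (L + 1) * (ε / (L + 1)) := by
        have : 0 < ε / ((L : ℝ) + 1) := by positivity
        linarith
    _ = ε := by field_simp

/-- A primitive of q is C¹, hence Lipschitz on the bounded range of r. Its composition with r is
absolutely continuous, and the chain rule holds almost everywhere. -/
theorem AbsolutelyContinuousOnInterval.continuousOn_comp_deriv {q r : ℝ → ℝ} {a b : ℝ}
    (hr : AbsolutelyContinuousOnInterval r a b) (hq : Continuous q) :
    ∫ t in a..b, q (r t) * deriv r t = ∫ x in r a..r b, q x := by
  have hQ : ∀ x, HasDerivAt (fun x => ∫ y in r a..x, q y) (q x) x := fun x =>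
    integral_hasDerivAt_right (hq.intervalIntegrable _ _)
      hq.aestronglyMeasurable.stronglyMeasurableAtFilter hq.continuousAt
  have hC : ContDiff ℝ 1 (fun x => ∫ y in r a..x, q y) := by
    rw [contDiff_one_iff_deriv]
    refine ⟨fun x => (hQ x).differentiableAt, ?_⟩
    rwa [funext fun x => (hQ x).deriv]
  obtain ⟨R, hR⟩ := hr.exists_bound
  obtain ⟨L, hL⟩ := hC.contDiffOn.exists_lipschitzOnWith (s := Icc (-R) R) (by decide)
    (convex_Icc _ _) isCompact_Icc
  have hac := hr.lipschitzOnWith_comp hL fun t ht => abs_le.1 (hR t ht)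
  have e := hac.integral_deriv_eq_sub
  simp only [integral_same, sub_zero] at e
  rw [← e]
  apply intervalIntegral.integral_congr_ae
  filter_upwards [hr.ae_differentiableAt] with t ht hmem
  have := (hQ (r t)).comp t (ht (uIoc_subset_uIcc hmem)).hasDerivAt
  exact this.deriv.symm

/-- The energy of a path `r` in the metric with density `c` along the clock with speed `e ^ h`. -/
noncomputable def pathEnergy (c r h : ℝ → ℝ) : ℝ≥0∞ :=
  ENNReal.ofReal (1 / 2) *
    ∫⁻ t in Icc (0 : ℝ) 1, ENNReal.ofReal ((c (r t) * deriv r t / √(Real.exp (h t))) ^ 2)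

namespace Profile

variable {f c r h : ℝ → ℝ} {z κ : ℝ}

/-- The level a is the maximum of r over [0, 1], not its terminal value, so that f(a) - f(r) ≥ 0 all
along the path. -/
theorem le_pathEnergy (hp : Profile f c) (hr : AbsolutelyContinuousOnInterval r 0 1)
    (hr0 : r 0 = 0) (hh : ContinuousOn h (Icc 0 1)) (hz : ∫ t in (0 : ℝ)..1, Real.exp (h t) = z)
    (hκ : ∫ t in (0 : ℝ)..1, Real.exp (h t) * f (r t) = κ) (h0 : z * f 0 < κ) :
    ∃ a > 0, κ < z * f a ∧
      ENNReal.ofReal (travelCost f c a ^ 2 / (2 * (z * f a - κ))) ≤ pathEnergy c r h := by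
  have cr : ContinuousOn r (Icc 0 1) := by
    have := hr.continuousOn
    rwa [uIcc_of_le zero_le_one] at this
  have ce : ContinuousOn (fun t => Real.exp (h t)) (Icc 0 1) := hh.rexp
  have cfr : ContinuousOn (fun t => f (r t)) (Icc 0 1) := hp.cont_f.comp_continuousOn cr
  have ii : ∀ u : ℝ → ℝ, ContinuousOn u (Icc 0 1) → IntervalIntegrable u volume 0 1 :=
    fun u hu => hu.intervalIntegrable_of_Icc zero_le_one
  obtain ⟨s, hs, hmax⟩ := isCompact_Icc.exists_isMaxOn ⟨(0 : ℝ), le_rfl, zero_le_one⟩ cr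
  have hfle : ∀ t ∈ Icc (0 : ℝ) 1, f (r t) ≤ f (r s) := fun t ht => hp.mono.monotone (hmax ht)
  have cef : ContinuousOn (fun t => Real.exp (h t) * f (r t)) (Icc 0 1) := ce.mul cfr
  have hdiff : ∀ v, ∫ t in (0 : ℝ)..1, Real.exp (h t) * (v - f (r t)) = z * v - κ := by
    intro v
    rw [← hz, ← hκ, ← intervalIntegral.integral_mul_const,
      ← intervalIntegral.integral_sub ((ii _ ce).mul_const _) (ii _ cef)]
    congr 1
    ext t
    ring
  have ha : 0 < r s := by
    by_contra hcon
    have : 0 ≤ ∫ t in (0 : ℝ)..1, Real.exp (h t) * (f 0 - f (r t)) := by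
      apply intervalIntegral.integral_nonneg zero_le_one
      intro t ht
      have := (hfle t ht).trans (hp.mono.monotone (not_lt.1 hcon))
      exact mul_nonneg (Real.exp_pos _).le (by linarith)
    rw [hdiff] at this
    linarith
  set a := r s with ha_def
  have cB : ContinuousOn (fun t => Real.exp (h t) * (f a - f (r t))) (Icc 0 1) :=
    ce.mul (continuousOn_const.sub cfr)
  have hB : 0 < z * f a - κ := by
    rw [← hdiff]
    apply integral_pos zero_lt_one cB
    · intro t ht
      exact mul_nonneg (Real.exp_pos _).le (by linarith [hfle t (Ioc_subset_Icc_self ht)])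
    · refine ⟨0, ⟨le_rfl, zero_le_one⟩, mul_pos (Real.exp_pos _) ?_⟩
      rw [hr0]
      exact sub_pos.2 (hp.mono ha)
  refine ⟨a, ha, by linarith, ?_⟩
  set A := travelCost f c a with hA
  set B := z * f a - κ with hBdef
  have hA0 : 0 < A := hp.travelCost_pos ha
  -- Maximizes μA - μ²B/2, with value A²/(2B).
  set μ := A / B with hμ
  have hμ0 : 0 < μ := div_pos hA0 hB
  have e1 : ∫ t in (0 : ℝ)..s, μ * (c (r t) * √(f a - f (r t)) * deriv r t) = μ * A := by
    rw [intervalIntegral.integral_const_mul]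
    congr 1
    have := (hr.mono (c := 0) (d := s) (by
      rw [uIcc_of_le hs.1, uIcc_of_le zero_le_one]
      exact Icc_subset_Icc_right hs.2)).continuousOn_comp_deriv (hp.continuous_cost_integrand (f a))
    rw [this, hr0]
    rfl
  -- The path up to the time s of its maximum already accounts for A; the remainder is nonnegative
  -- once absolute values are taken.
  have e2 : ENNReal.ofReal (μ * A) ≤ ∫⁻ t in Icc (0 : ℝ) 1,
      ENNReal.ofReal |μ * (c (r t) * √(f a - f (r t)) * deriv r t)| := by
    rw [← e1, integral_of_le hs.1]
    refine (ENNReal.ofReal_le_ofReal (le_abs_self _)).trans ?_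
    rw [← Real.norm_eq_abs, ofReal_norm]
    refine (enorm_integral_le_lintegral_enorm _).trans ?_
    refine (lintegral_mono_set (Ioc_subset_Icc_self.trans (Icc_subset_Icc_right hs.2))).trans ?_
    apply le_of_eq
    congr 1
    ext t
    rw [← Real.norm_eq_abs, ofReal_norm]
  have cq : ContinuousOn (fun t => μ ^ 2 / 2 * (Real.exp (h t) * (f a - f (r t)))) (Icc 0 1) :=
    cB.const_mul _
  -- Young's inequality |pq| ≤ p²/2 + q²/2, the weight √(e^h) being shared between p and q.
  have e3 : ∫⁻ t in Icc (0 : ℝ) 1, ENNReal.ofReal |μ * (c (r t) * √(f a - f (r t)) * deriv r t)|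
      ≤ ∫⁻ t in Icc (0 : ℝ) 1, (ENNReal.ofReal (1 / 2) *
          ENNReal.ofReal ((c (r t) * deriv r t / √(Real.exp (h t))) ^ 2)
        + ENNReal.ofReal (μ ^ 2 / 2 * (Real.exp (h t) * (f a - f (r t))))) := by
    apply setLIntegral_mono' measurableSet_Icc
    intro t ht
    have hX : 0 ≤ f a - f (r t) := sub_nonneg.2 (hfle t ht)
    have hE := Real.exp_pos (h t)
    have hE' : 0 < √(Real.exp (h t)) := Real.sqrt_pos.2 hE
    rw [← ENNReal.ofReal_mul (by norm_num), ← ENNReal.ofReal_add (by positivity) (by positivity)]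
    apply ENNReal.ofReal_le_ofReal
    set p := c (r t) * deriv r t / √(Real.exp (h t)) with hpdef
    set q := μ * √(f a - f (r t)) * √(Real.exp (h t)) with hqdef
    have hpq : μ * (c (r t) * √(f a - f (r t)) * deriv r t) = p * q := by
      rw [hpdef, hqdef]
      field_simp
    have hq2 : q ^ 2 = μ ^ 2 * (Real.exp (h t) * (f a - f (r t))) := by
      rw [hqdef, mul_pow, mul_pow, Real.sq_sqrt hX, Real.sq_sqrt hE.le]
      ring
    rw [hpq, abs_le]
    constructor
    · nlinarith [sq_nonneg (p + q)]
    · nlinarith [sq_nonneg (p - q)]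
  have e4 : ∫⁻ t in Icc (0 : ℝ) 1, ENNReal.ofReal (μ ^ 2 / 2 * (Real.exp (h t) * (f a - f (r t))))
      = ENNReal.ofReal (μ ^ 2 / 2 * B) := by
    rw [← ofReal_integral_eq_lintegral_ofReal cq.integrableOn_Icc]
    · rw [integral_Icc_eq_integral_Ioc, ← integral_of_le zero_le_one,
        intervalIntegral.integral_const_mul, hdiff]
    · refine (ae_restrict_iff' measurableSet_Icc).2 (Eventually.of_forall fun t ht => ?_)
      have hX : 0 ≤ f a - f (r t) := sub_nonneg.2 (hfle t ht)
      have := Real.exp_pos (h t)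
      simp only [Pi.zero_apply]
      positivity
  rw [lintegral_add_right' _ (cq.aemeasurable measurableSet_Icc).ennreal_ofReal,
    lintegral_const_mul' _ _ ENNReal.ofReal_ne_top, e4] at e3
  have e5 := e2.trans e3
  have e6 : A ^ 2 / (2 * B) = μ * A - μ ^ 2 / 2 * B := by
    rw [hμ]; field_simp; ring
  rw [e6, ENNReal.ofReal_sub _ (by positivity)]
  exact tsub_le_iff_right.2 e5

end Profile

/-! ### Construction of extremal paths. -/

/-- A locally integrable positive density which equals `1` outside a bounded interval has a
primitive with a continuous inverse. -/
theorem exists_inverse_primitive {w : ℝ → ℝ} {a : ℝ} (ha : 0 < a) (hw : ∀ x, 0 < w x)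
    (hi : IntervalIntegrable w volume 0 a) (hc : ContinuousOn w (Ioo 0 a))
    (hout : ∀ x ∉ Ioo 0 a, w x = 1) :
    ∃ ρ : ℝ → ℝ, Continuous ρ ∧ StrictMono ρ ∧ ρ 0 = 0 ∧ ρ (∫ x in (0 : ℝ)..a, w x) = a ∧
      ∀ s ∈ Ioo 0 (∫ x in (0 : ℝ)..a, w x), ρ s ∈ Ioo 0 a ∧ HasDerivAt ρ (w (ρ s))⁻¹ s := by
  have i1 : ∀ x y, (∀ t ∈ uIoc x y, w t = 1) → IntervalIntegrable w volume x y := fun x y hxy =>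
    (intervalIntegrable_const (c := (1 : ℝ))).congr fun t ht => (hxy t ht).symm
  have hneg : ∀ x ≤ 0, ∀ t ∈ uIoc 0 x, w t = 1 := by
    intro x hx t ht
    rw [uIoc_of_ge hx] at ht
    exact hout t fun h => absurd ht.2 (not_le.2 h.1)
  have hpos : ∀ x ≥ a, ∀ t ∈ uIoc a x, w t = 1 := by
    intro x hx t ht
    rw [uIoc_of_le hx] at ht
    exact hout t fun h => absurd ht.1 (not_lt.2 h.2.le)
  have i0 : ∀ x, IntervalIntegrable w volume 0 x := by
    intro x
    rcases le_total x 0 with h | h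
    · exact i1 _ _ (hneg x h)
    rcases le_total x a with h' | h'
    · exact hi.mono_set (by rw [uIcc_of_le h, uIcc_of_le ha.le]; exact Icc_subset_Icc_right h')
    · exact hi.trans (i1 _ _ (hpos x h'))
  have ixy : ∀ x y, IntervalIntegrable w volume x y := fun x y => (i0 x).symm.trans (i0 y)
  set W : ℝ → ℝ := fun x => ∫ y in (0 : ℝ)..x, w y with hW
  have hWc : Continuous W := continuous_primitive ixy 0
  have hWm : StrictMono W := by
    intro x y hxy
    have e : W y - W x = ∫ t in x..y, w t := integral_interval_sub_left (i0 y) (i0 x)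
    have := intervalIntegral_pos_of_pos_on (ixy x y) (fun t _ => hw t) hxy
    linarith
  have hW0 : W 0 = 0 := integral_same
  have hWneg : ∀ x ≤ 0, W x = x := by
    intro x hx
    have : W x = ∫ t in (0 : ℝ)..x, (1 : ℝ) :=
      intervalIntegral.integral_congr_ae (Eventually.of_forall fun t ht => hneg x hx t ht)
    simpa using this
  have hWpos : ∀ x ≥ a, W x = W a + (x - a) := by
    intro x hx
    have e : W x - W a = ∫ t in a..x, w t := integral_interval_sub_left (i0 x) (i0 a)
    have : ∫ t in a..x, w t = ∫ t in a..x, (1 : ℝ) :=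
      intervalIntegral.integral_congr_ae (Eventually.of_forall fun t ht => hpos x hx t ht)
    rw [this] at e
    simp at e
    linarith
  have hsurj : Function.Surjective W := by
    apply hWc.surjective
    · have h1 : Tendsto (fun x => W a + (x - a)) atTop atTop :=
        tendsto_atTop_add_const_left _ _ (tendsto_atTop_add_const_right _ _ tendsto_id)
      refine h1.congr' ?_
      filter_upwards [eventually_ge_atTop a] with x hx using (hWpos x hx).symm
    · refine tendsto_id.congr' ?_
      filter_upwards [eventually_le_atBot 0] with x hx using (hWneg x hx).symm
  set e := StrictMono.orderIsoOfSurjective W hWm hsurj with he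
  have he' : ∀ x, e x = W x := fun x => rfl
  have hl : ∀ x, e.symm (W x) = x := fun x => e.symm_apply_apply x
  have hr : ∀ s, W (e.symm s) = s := fun s => e.apply_symm_apply s
  refine ⟨e.symm, e.symm.continuous, e.symm.strictMono, ?_, hl a, ?_⟩
  · have := hl 0
    rwa [hW0] at this
  intro s hs
  have hm : e.symm s ∈ Ioo 0 a := by
    constructor
    · have := e.symm.strictMono hs.1
      rwa [← hW0, hl] at this
    · have := e.symm.strictMono hs.2
      rwa [show (∫ x in (0 : ℝ)..a, w x) = W a from rfl, hl] at this
  refine ⟨hm, ?_⟩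
  have hd : HasDerivAt W (w (e.symm s)) (e.symm s) :=
    integral_hasDerivAt_right (i0 _) (hc.stronglyMeasurableAtFilter isOpen_Ioo _ hm)
      (hc.continuousAt (isOpen_Ioo.mem_nhds hm))
  exact HasDerivAt.of_local_left_inverse e.symm.continuous.continuousAt hd (hw _).ne'
    (Eventually.of_forall hr)

namespace IsExtremal

variable {f c h : ℝ → ℝ} {z κ a : ℝ}

/-- An extremal level is reached by a path whose energy is the reduced value. -/
theorem exists_path (hex : IsExtremal f c z κ a) (hp : Profile f c)
    (hh : ContinuousOn h (Icc 0 1)) (hz : ∫ t in (0 : ℝ)..1, Real.exp (h t) = z) :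
    ∃ r, AbsolutelyContinuousOnInterval r 0 1 ∧ r 0 = 0 ∧
      (∫ t in (0 : ℝ)..1, Real.exp (h t) * f (r t) = κ) ∧
      pathEnergy c r h = ENNReal.ofReal (travelCost f c a ^ 2 / (2 * (z * f a - κ))) := by
  have ha := hex.pos
  have cf := hp.cont_f
  have cc := hp.cont_c
  -- A continuous extension of h to the whole line, so that primitives are differentiable at the
  -- endpoints as well.
  set k : ℝ → ℝ := fun t => h (projIcc 0 1 zero_le_one t) with hk
  have ck : Continuous k := hh.comp_continuous (continuous_projIcc.subtype_val) fun t =>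
    (projIcc 0 1 zero_le_one t).2
  have hkh : ∀ t ∈ Icc (0 : ℝ) 1, k t = h t := fun t ht => by
    simp only [hk, projIcc_of_mem zero_le_one ht]
  have hkz : ∫ t in (0 : ℝ)..1, Real.exp (k t) = z := by
    rw [← hz]
    apply integral_congr
    intro t ht
    rw [uIcc_of_le zero_le_one] at ht
    simp only [hkh t ht]
  have hz0 : 0 < z := by
    rw [← hkz]
    exact intervalIntegral_pos_of_pos (Continuous.intervalIntegrable (by fun_prop) _ _)
      (fun _ => Real.exp_pos _) zero_lt_one
  have hA0 : 0 < travelCost f c a := hp.travelCost_pos ha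
  have hB : 0 < z * f a - κ := sub_pos.2 (hex.lt_mul hp hz0)
  have hBT := hex.excess_mul hp
  set A := travelCost f c a with hA
  set B := z * f a - κ with hBdef
  set μ := A / B with hμ
  have hμ0 : 0 < μ := div_pos hA0 hB
  -- Clock time spent per unit of level. The value 1 outside (0, a) makes its primitive a
  -- homeomorphism of the line.
  set w : ℝ → ℝ := (Ioo 0 a).piecewise (fun x => μ⁻¹ * (c x / √(f a - f x))) 1 with hw
  have hwin : ∀ x ∈ Ioo 0 a, w x = μ⁻¹ * (c x / √(f a - f x)) := fun x hx =>
    piecewise_eq_of_mem _ _ _ hx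
  have hwout : ∀ x ∉ Ioo 0 a, w x = 1 := fun x hx => piecewise_eq_of_notMem _ _ _ hx
  have hsq : ∀ x ∈ Ioo 0 a, 0 < √(f a - f x) := fun x hx =>
    Real.sqrt_pos.2 (sub_pos.2 (hp.mono hx.2))
  have hw0 : ∀ x, 0 < w x := by
    intro x
    by_cases hx : x ∈ Ioo 0 a
    · rw [hwin x hx]
      have := hp.c_pos x
      have := hsq x hx
      positivity
    · rw [hwout x hx]
      exact one_pos
  have hae : ∀ᵐ x, x ∈ uIoc 0 a → μ⁻¹ * (c x / √(f a - f x)) = w x := by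
    filter_upwards [compl_mem_ae_iff.2 (measure_singleton a)] with x hx hxa
    rw [uIoc_of_le ha.le] at hxa
    exact (hwin x ⟨hxa.1, lt_of_le_of_ne hxa.2 hx⟩).symm
  have hwi : IntervalIntegrable w volume 0 a :=
    (hex.integrable.const_mul μ⁻¹).congr_ae ((ae_restrict_iff' measurableSet_uIoc).2 hae)
  have hwc : ContinuousOn w (Ioo 0 a) :=
    ((hp.continuousOn_time_integrand fun x hx => hp.mono hx.2).const_mul μ⁻¹).congr hwin
  -- The travel time is T/μ = TB/A, which equals z precisely by extremality.
  have hwz : ∫ x in (0 : ℝ)..a, w x = z := by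
    rw [← intervalIntegral.integral_congr_ae hae, intervalIntegral.integral_const_mul]
    change μ⁻¹ * travelTime f c a = z
    rw [hμ]
    field_simp
    linarith
  obtain ⟨ρ, ρc, ρm, ρ0, ρa, hρ⟩ := exists_inverse_primitive ha hw0 hwi hwc hwout
  rw [hwz] at ρa hρ
  set S : ℝ → ℝ := fun t => ∫ x in (0 : ℝ)..t, Real.exp (k x) with hS
  have hek : Continuous fun t => Real.exp (k t) := by fun_prop
  have hSd : ∀ t, HasDerivAt S (Real.exp (k t)) t := fun t =>
    integral_hasDerivAt_right (hek.intervalIntegrable _ _)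
      hek.aestronglyMeasurable.stronglyMeasurableAtFilter hek.continuousAt
  have hSc : Continuous S := continuous_iff_continuousAt.2 fun t => (hSd t).continuousAt
  have hSm : StrictMono S := strictMono_of_hasDerivAt_pos hSd fun t => Real.exp_pos _
  have hS0 : S 0 = 0 := integral_same
  have hS1 : S 1 = z := hkz
  set R : ℝ → ℝ := fun t => ρ (S t) with hR
  have hRc : Continuous R := ρc.comp hSc
  have hR0 : R 0 = 0 := by simp only [hR, hS0, ρ0]
  have hR1 : R 1 = a := by simp only [hR, hS1, ρa]
  have hRmem : ∀ t ∈ Icc (0 : ℝ) 1, R t ≤ a := fun t ht => by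
    rw [← hR1]
    exact (ρm.comp hSm).monotone ht.2
  set v : ℝ → ℝ := fun t => μ * √(f a - f (R t)) / c (R t) * Real.exp (k t) with hv
  have hvc : Continuous v := by
    apply Continuous.mul _ hek
    apply Continuous.div (by fun_prop) (cc.comp hRc) fun t => (hp.c_pos _).ne'
  have hRd : ∀ t ∈ Ioo (0 : ℝ) 1, HasDerivAt R (v t) t := by
    intro t ht
    have hSt : S t ∈ Ioo 0 z := ⟨by rw [← hS0]; exact hSm ht.1, by rw [← hS1]; exact hSm ht.2⟩
    obtain ⟨hm, hd⟩ := hρ _ hSt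
    have := hd.comp t (hSd t)
    rw [hwin _ hm] at this
    have h1 := hsq _ hm
    have h2 := hp.c_pos (ρ (S t))
    have e : v t = (μ⁻¹ * (c (ρ (S t)) / √(f a - f (ρ (S t)))))⁻¹ * Real.exp (k t) := by
      simp only [hv, hR]
      field_simp
    rw [e]
    exact this
  have hvi : ∀ x y, IntervalIntegrable v volume x y := fun x y => hvc.intervalIntegrable _ _
  -- R is known to be differentiable only on (0, 1); this primitive agrees with it on [0, 1] and is
  -- C¹ everywhere.
  set r : ℝ → ℝ := fun t => ∫ x in (0 : ℝ)..t, v x with hr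
  have hrR : ∀ t ∈ Icc (0 : ℝ) 1, r t = R t := by
    intro t ht
    have := integral_eq_sub_of_hasDerivAt_of_le ht.1 hRc.continuousOn
      (fun x hx => hRd x ⟨hx.1, hx.2.trans_le ht.2⟩) (hvi 0 t)
    rw [hR0, sub_zero] at this
    exact this
  have hrd : ∀ t, HasDerivAt r (v t) t := fun t =>
    integral_hasDerivAt_right (hvi _ _)
      hvc.aestronglyMeasurable.stronglyMeasurableAtFilter hvc.continuousAt
  -- Substituting x = R(t) in A gives A = μ ∫ e^k (f(a) - f(R)), and A = μB.
  have hcons : ∫ t in (0 : ℝ)..1, Real.exp (k t) * (f a - f (R t)) = B := by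
    have cq := hp.continuous_cost_integrand (f a)
    have hQ : ∀ x, HasDerivAt (fun x => ∫ y in (0 : ℝ)..x, c y * √(f a - f y))
        (c x * √(f a - f x)) x := fun x =>
      integral_hasDerivAt_right (cq.intervalIntegrable _ _)
        cq.aestronglyMeasurable.stronglyMeasurableAtFilter cq.continuousAt
    have hQc : Continuous (fun x => ∫ y in (0 : ℝ)..x, c y * √(f a - f y)) :=
      continuous_iff_continuousAt.2 fun x => (hQ x).continuousAt
    have := integral_eq_sub_of_hasDerivAt_of_le zero_le_one
      (f := fun t => ∫ y in (0 : ℝ)..R t, c y * √(f a - f y))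
      (f' := fun t => c (R t) * √(f a - f (R t)) * v t) (hQc.comp hRc).continuousOn
      (fun t ht => (hQ (R t)).comp t (hRd t ht))
      (Continuous.intervalIntegrable ((cq.comp hRc).mul hvc) _ _)
    simp only [hR0, hR1, integral_same, sub_zero] at this
    have e : ∫ t in (0 : ℝ)..1, c (R t) * √(f a - f (R t)) * v t
        = μ * ∫ t in (0 : ℝ)..1, Real.exp (k t) * (f a - f (R t)) := by
      rw [← intervalIntegral.integral_const_mul]
      apply integral_congr
      intro t ht
      rw [uIcc_of_le zero_le_one] at ht
      have hX : 0 ≤ f a - f (R t) := sub_nonneg.2 (hp.mono.monotone (hRmem t ht))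
      have h2 := hp.c_pos (R t)
      simp only [hv]
      field_simp
      rw [Real.sq_sqrt hX]
    rw [e] at this
    have h3 : μ * B = A := by rw [hμ]; field_simp
    exact mul_left_cancel₀ hμ0.ne' (this.trans h3.symm)
  refine ⟨r, ?_, integral_same, ?_, ?_⟩
  · exact (hvi 0 1).absolutelyContinuousOnInterval_intervalIntegral left_mem_uIcc
  · have e : ∫ t in (0 : ℝ)..1, Real.exp (h t) * f (r t)
        = ∫ t in (0 : ℝ)..1, (f a * Real.exp (k t) - Real.exp (k t) * (f a - f (R t))) := by
      apply integral_congr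
      intro t ht
      rw [uIcc_of_le zero_le_one] at ht
      simp only [hrR t ht, hkh t ht]
      ring
    rw [e, intervalIntegral.integral_sub (Continuous.intervalIntegrable (by fun_prop) _ _)
      (Continuous.intervalIntegrable (by fun_prop) _ _), intervalIntegral.integral_const_mul,
      hkz, hcons]
    ring
  · unfold pathEnergy
    have e : ∫⁻ t in Icc (0 : ℝ) 1, ENNReal.ofReal ((c (r t) * deriv r t / √(Real.exp (h t))) ^ 2)
        = ∫⁻ t in Icc (0 : ℝ) 1, ENNReal.ofReal (μ ^ 2 * (Real.exp (k t) * (f a - f (R t)))) := by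
      apply setLIntegral_congr_fun measurableSet_Icc
      intro t ht
      have hX : 0 ≤ f a - f (R t) := sub_nonneg.2 (hp.mono.monotone (hRmem t ht))
      have h2 := hp.c_pos (R t)
      have hE := Real.exp_pos (h t)
      simp only [(hrd t).deriv, hrR t ht, hv, hkh t ht]
      congr 1
      rw [div_pow, Real.sq_sqrt hE.le]
      field_simp
      rw [Real.sq_sqrt hX]
    have ci : Continuous fun t => μ ^ 2 * (Real.exp (k t) * (f a - f (R t))) := by fun_prop
    rw [e, ← ofReal_integral_eq_lintegral_ofReal ci.continuousOn.integrableOn_Icc,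
      integral_Icc_eq_integral_Ioc, ← integral_of_le zero_le_one,
      intervalIntegral.integral_const_mul, hcons, ← ENNReal.ofReal_mul (by norm_num)]
    · congr 1
      rw [hμ]
      field_simp
    · refine (ae_restrict_iff' measurableSet_Icc).2 (Eventually.of_forall fun t ht => ?_)
      have hX : 0 ≤ f a - f (R t) := sub_nonneg.2 (hp.mono.monotone (hRmem t ht))
      have := Real.exp_pos (k t)
      simp only [Pi.zero_apply]
      positivity

end IsExtremal

/-! ### Truncation of variance paths. -/

/-- The energy of a log-variance path. -/
noncomputable def varianceEnergy (σ h : ℝ → ℝ) : ℝ≥0∞ :=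
  ENNReal.ofReal (1 / 2) *
    (∫⁻ t in Icc (0 : ℝ) 1, ENNReal.ofReal ((deriv h t / σ (Real.exp (h t))) ^ 2))

theorem asianRate_le_varianceEnergy {σ h : ℝ → ℝ} {V₀ z : ℝ} (hh : AdmissiblePath V₀ z h) :
    asianRate σ V₀ z ≤ varianceEnergy σ h :=
  iInf₂_le h hh

theorem varianceEnergy_le {σ h k : ℝ → ℝ}
    (hk : ∀ t ∈ Ioo (0 : ℝ) 1, k =ᶠ[𝓝 t] h ∨ deriv k t = 0) :
    varianceEnergy σ k ≤ varianceEnergy σ h := by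
  unfold varianceEnergy
  gcongr ENNReal.ofReal (1 / 2) * ?_
  rw [← setLIntegral_congr Ioo_ae_eq_Icc, ← setLIntegral_congr (Ioo_ae_eq_Icc (a := (0 : ℝ)))]
  apply setLIntegral_mono' measurableSet_Ioo
  intro t ht
  rcases hk t ht with h1 | h1
  · rw [h1.deriv_eq, h1.eq_of_nhds]
  · simp [h1]

theorem AbsolutelyContinuousOnInterval.clamp {h : ℝ → ℝ} {a b : ℝ}
    (hh : AbsolutelyContinuousOnInterval h a b) (l u : ℝ) :
    AbsolutelyContinuousOnInterval (fun t => max l (min (h t) u)) a b := by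
  have hL : LipschitzWith 1 (fun x : ℝ => max l (min x u)) :=
    (LipschitzWith.id.min_const u).const_max l
  exact hh.lipschitzOnWith_comp (φ := fun x => max l (min x u)) hL.lipschitzOnWith
    (mapsTo_univ _ _)

/-- Where a bound is active the clamped path has an extremum, so `deriv` vanishes there, if need be
by its default value at a point of nondifferentiability. -/
theorem clamp_eventuallyEq_or_deriv_eq_zero {h : ℝ → ℝ} {l u t : ℝ} (hlu : l ≤ u)
    (hc : ContinuousAt h t) :
    (fun s => max l (min (h s) u)) =ᶠ[𝓝 t] h ∨ deriv (fun s => max l (min (h s) u)) t = 0 := by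
  rcases le_or_gt (h t) l with h1 | h1
  · right
    apply IsLocalMin.deriv_eq_zero
    refine Eventually.of_forall fun s => ?_
    simp only [min_eq_left (h1.trans hlu), max_eq_left h1]
    exact le_max_left _ _
  rcases le_or_gt u (h t) with h2 | h2
  · right
    apply IsLocalMax.deriv_eq_zero
    refine Eventually.of_forall fun s => ?_
    simp only [min_eq_right h2, max_eq_right hlu]
    exact max_le hlu (min_le_right _ _)
  · left
    filter_upwards [hc.eventually (lt_mem_nhds h1), hc.eventually (gt_mem_nhds h2)] with s h3 h4
    rw [min_eq_left h4.le, max_eq_right h3.le]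

/-- The integrated variance of an admissible path can be moved towards `V₀` without raising the
energy. -/
theorem AdmissiblePath.exists_truncation {σ h : ℝ → ℝ} {V₀ z z' : ℝ} (hV₀ : 0 < V₀)
    (hh : AdmissiblePath V₀ z h) (hz' : z' ∈ uIcc V₀ z) :
    ∃ k, AdmissiblePath V₀ z' k ∧ varianceEnergy σ k ≤ varianceEnergy σ h := by
  have hc : ContinuousOn h (Icc 0 1) := by
    have := hh.ac_h.continuousOn
    rwa [uIcc_of_le zero_le_one] at this
  obtain ⟨C, hC⟩ := hh.ac_h.exists_bound
  rw [uIcc_of_le zero_le_one] at hC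
  have hC0 := abs_le.1 (hC 0 ⟨le_rfl, zero_le_one⟩)
  set v := Real.log V₀ with hv
  rw [hh.h_zero] at hC0
  set p : ℝ → ℝ := fun t => h (projIcc 0 1 zero_le_one t) with hp
  have cp : Continuous p := hc.comp_continuous (continuous_projIcc.subtype_val) fun t =>
    (projIcc 0 1 zero_le_one t).2
  have hph : ∀ t ∈ Icc (0 : ℝ) 1, p t = h t := fun t ht => by
    simp only [hp, projIcc_of_mem zero_le_one ht]
  -- The clamping window grows from the single point log V₀ at θ = 0 to [-C, C] at θ = 1, where it
  -- leaves h unchanged; the intermediate value theorem then hits z'.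
  set l : ℝ → ℝ := fun θ => v + θ * (-C - v) with hl
  set u : ℝ → ℝ := fun θ => v + θ * (C - v) with hu
  set Φ : ℝ → ℝ := fun θ => ∫ t in (0 : ℝ)..1, Real.exp (max (l θ) (min (p t) (u θ))) with hΦ
  have cΦ : Continuous Φ := by
    apply intervalIntegral.continuous_parametric_intervalIntegral_of_continuous'
    simp only [Function.uncurry_def, hl, hu]
    fun_prop
  have h0 : Φ 0 = V₀ := by
    have : ∀ t, max (l 0) (min (p t) (u 0)) = v := fun t => by
      simp only [hl, hu, zero_mul, add_zero]
      exact max_eq_left (min_le_right _ _)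
    simp only [hΦ, this]
    simp [hv, Real.exp_log hV₀]
  have h1 : Φ 1 = z := by
    rw [← hh.constraint]
    apply integral_congr
    intro t ht
    rw [uIcc_of_le zero_le_one] at ht
    have := abs_le.1 (hC t ht)
    simp only [hl, hu, hph t ht, one_mul, add_sub_cancel]
    rw [min_eq_left this.2, max_eq_right this.1]
  have := intermediate_value_uIcc (a := (0 : ℝ)) (b := 1) cΦ.continuousOn
  rw [h0, h1] at this
  obtain ⟨θ, hθ, hθz⟩ := this hz'
  rw [uIcc_of_le zero_le_one] at hθ
  have hlv : l θ ≤ v := by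
    have : θ * (-C - v) ≤ 0 := mul_nonpos_of_nonneg_of_nonpos hθ.1 (by linarith)
    simp only [hl]; linarith
  have hvu : v ≤ u θ := by
    have : 0 ≤ θ * (C - v) := mul_nonneg hθ.1 (by linarith)
    simp only [hu]; linarith
  refine ⟨fun t => max (l θ) (min (h t) (u θ)), ⟨?_, ?_, ?_⟩, ?_⟩
  · exact hh.ac_h.clamp _ _
  · simp only [hh.h_zero]
    rw [min_eq_left hvu, max_eq_right hlv]
  · rw [← hθz]
    apply integral_congr
    intro t ht
    rw [uIcc_of_le zero_le_one] at ht
    simp only [hph t ht]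
  · refine varianceEnergy_le fun t ht => ?_
    exact clamp_eventuallyEq_or_deriv_eq_zero (hlv.trans hvu) (hc.continuousAt
      (Icc_mem_nhds ht.1 ht.2))

/-! ### Lower bound by the reduced infimum. -/

namespace Profile

variable {f c : ℝ → ℝ} {κ : ℝ}

theorem travelCost_sq_le (hp : Profile f c) {y C : ℝ} (hy : 0 ≤ y)
    (hC : ∀ r ∈ Icc 0 y, c r ≤ C) : travelCost f c y ^ 2 ≤ (y * C) ^ 2 * (f y - f 0) := by
  have h1 : travelCost f c y ≤ ∫ r in (0 : ℝ)..y, C * √(f y - f 0) := by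
    apply integral_mono_on hy ((hp.continuous_cost_integrand _).intervalIntegrable _ _) (by simp)
    intro r hr
    have h1 := hp.mono.monotone hr.1
    have h2 := hC r hr
    have := (hp.c_pos r).le.trans h2
    gcongr
  rw [intervalIntegral.integral_const, smul_eq_mul, sub_zero] at h1
  have h2 : 0 ≤ f y - f 0 := sub_nonneg.2 (hp.mono.monotone hy)
  have h3 := hp.travelCost_nonneg hy
  calc travelCost f c y ^ 2 ≤ (y * (C * √(f y - f 0))) ^ 2 := by gcongr
    _ = _ := by rw [mul_pow, mul_pow, Real.sq_sqrt h2]; ring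

/-- Near the boundary of the domain the reduced cost is arbitrarily small. -/
theorem exists_small_value (hp : Profile f c) {V₀ z δ : ℝ} (hV₀ : 0 < V₀) (hz : 0 < z)
    (h0 : V₀ * f 0 < κ) (h1 : κ ≤ z * f 0) (hδ : 0 < δ) :
    ∃ z' ∈ uIcc V₀ z, 0 < z' ∧ z' * f 0 < κ ∧ ∃ y > 0, κ < z' * f y ∧
      travelCost f c y ^ 2 / (2 * (z' * f y - κ)) ≤ δ := by
  have hf0 : f 0 ≠ 0 := by
    intro h
    rw [h] at h0 h1
    linarith
  set z₀ := κ / f 0 with hz₀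
  have hz₀κ : z₀ * f 0 = κ := by rw [hz₀]; field_simp
  have hmem : z₀ ∈ uIcc V₀ z := by
    rw [mem_uIcc]
    -- The boundary value z₀ lies between V₀ and z in either orientation: f(0) < 0 as for the put,
    -- f(0) > 0 as for the call.
    rcases lt_or_gt_of_ne hf0 with h | h
    · right
      constructor
      · exact le_of_not_gt fun hlt => by nlinarith
      · exact le_of_not_gt fun hlt => by nlinarith
    · left
      constructor
      · exact le_of_mul_le_mul_right (by linarith) h
      · exact le_of_mul_le_mul_right (by linarith) h
  have hpos : ∀ x ∈ uIcc V₀ z, 0 < x := fun x hx => (lt_min hV₀ hz).trans_le hx.1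
  have hz₀0 := hpos _ hmem
  obtain ⟨C, hC⟩ := (isCompact_Icc (a := (0 : ℝ)) (b := 1)).exists_bound_of_continuousOn
    hp.cont_c.continuousOn
  -- At z₀ one has B = z₀ (f(y) - f(0)), which cancels the same factor in the bound for A² and
  -- leaves (yC)²/(2z₀).
  have hy : ∃ y, 0 < y ∧ y ≤ 1 ∧ (y * C) ^ 2 / (2 * z₀) < δ := by
    have cy : Continuous fun y : ℝ => (y * C) ^ 2 / (2 * z₀) := by fun_prop
    have ht := (cy.tendsto 0).mono_left (nhdsWithin_le_nhds (s := Ioi 0))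
    simp only [zero_mul, ne_eq, OfNat.ofNat_ne_zero, not_false_eq_true, zero_pow, zero_div] at ht
    obtain ⟨y, hy1, hy2⟩ := ((ht.eventually (gt_mem_nhds hδ)).and
      (Ioc_mem_nhdsGT zero_lt_one)).exists
    exact ⟨y, hy2.1, hy2.2, hy1⟩
  obtain ⟨y, hy0, hy1, hyδ⟩ := hy
  have hfy := hp.mono hy0
  -- A small step from z₀ towards V₀ enters the domain, and continuity preserves the strict bound.
  set ζ : ℝ → ℝ := fun θ => z₀ + θ * (V₀ - z₀) with hζ
  have cζ : Continuous ζ := by fun_prop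
  have hζ0 : ζ 0 = z₀ := by simp [hζ]
  have hB0 : 0 < ζ 0 * f y - κ := by
    rw [hζ0, ← hz₀κ, ← mul_sub]
    exact mul_pos hz₀0 (sub_pos.2 hfy)
  have hA := hp.travelCost_sq_le (C := C) hy0.le fun r hr =>
    (le_abs_self _).trans (hC r ⟨hr.1, hr.2.trans hy1⟩)
  have hval : travelCost f c y ^ 2 / (2 * (ζ 0 * f y - κ)) < δ := by
    refine lt_of_le_of_lt ?_ hyδ
    have e : ζ 0 * f y - κ = z₀ * (f y - f 0) := by rw [hζ0, ← hz₀κ]; ring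
    rw [e]
    have hd := sub_pos.2 hfy
    rw [div_le_div_iff₀ (by positivity) (by positivity)]
    nlinarith
  have ev1 : ∀ᶠ θ in 𝓝[>] (0 : ℝ), 0 < ζ θ * f y - κ := by
    have : Continuous fun θ => ζ θ * f y - κ := by fun_prop
    exact ((this.tendsto 0).eventually (lt_mem_nhds hB0)).filter_mono nhdsWithin_le_nhds
  have ev2 : ∀ᶠ θ in 𝓝[>] (0 : ℝ), travelCost f c y ^ 2 / (2 * (ζ θ * f y - κ)) < δ := by
    have : ContinuousAt (fun θ => travelCost f c y ^ 2 / (2 * (ζ θ * f y - κ))) 0 := by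
      apply ContinuousAt.div (by fun_prop) (by fun_prop)
      positivity
    exact (this.eventually (gt_mem_nhds hval)).filter_mono nhdsWithin_le_nhds
  obtain ⟨θ, h2, h3, h4⟩ := (ev1.and (ev2.and (Ioo_mem_nhdsGT zero_lt_one))).exists
  have hmemθ : ζ θ ∈ uIcc V₀ z := by
    have := (convex_uIcc V₀ z) left_mem_uIcc hmem h4.1.le (sub_nonneg.2 h4.2.le) (by ring)
    convert this using 1
    simp only [hζ, smul_eq_mul]
    ring
  refine ⟨ζ θ, hmemθ, hpos _ hmemθ, ?_, y, hy0, by linarith, h3.le⟩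
  have : ζ θ * f 0 = κ + θ * (V₀ * f 0 - κ) := by
    simp only [hζ]
    linear_combination (1 - θ) * hz₀κ
  rw [this]
  nlinarith [h4.1]

/-- The reduced infimum bounds the total energy of every admissible pair from below. -/
theorem iInf_le_energy (hp : Profile f c) {σ : ℝ → ℝ} {V₀ : ℝ} (hV₀ : 0 < V₀)
    (h0 : V₀ * f 0 < κ) {D : Set ℝ}
    (hD : ∀ z, z ∈ D ↔ 0 < z ∧ z * f 0 < κ ∧ ∃ b, κ < z * f b) {m : ℝ → ℝ≥0∞}
    (hm : ∀ z ∈ D, ∀ y > 0, κ < z * f y →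
      m z ≤ ENNReal.ofReal (travelCost f c y ^ 2 / (2 * (z * f y - κ))))
    {r h : ℝ → ℝ} (hr : AbsolutelyContinuousOnInterval r 0 1) (hr0 : r 0 = 0)
    (hh : AbsolutelyContinuousOnInterval h 0 1) (hh0 : h 0 = Real.log V₀)
    (hκ : ∫ t in (0 : ℝ)..1, Real.exp (h t) * f (r t) = κ) :
    ⨅ z ∈ D, (m z + asianRate σ V₀ z) ≤ pathEnergy c r h + varianceEnergy σ h := by
  have hc : ContinuousOn h (Icc 0 1) := by
    have := hh.continuousOn
    rwa [uIcc_of_le zero_le_one] at this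
  set z := ∫ t in (0 : ℝ)..1, Real.exp (h t) with hz
  have hadm : AdmissiblePath V₀ z h := ⟨hh, hh0, rfl⟩
  have hz0 : 0 < z := intervalIntegral_pos_of_pos_on
    (hc.rexp.intervalIntegrable_of_Icc zero_le_one) (fun _ _ => Real.exp_pos _) zero_lt_one
  rcases lt_or_ge (z * f 0) κ with hlt | hge
  · obtain ⟨a, ha, hB, hle⟩ := hp.le_pathEnergy hr hr0 hc hz.symm hκ hlt
    have hzD : z ∈ D := (hD z).2 ⟨hz0, hlt, a, hB⟩
    exact (iInf₂_le z hzD).trans (add_le_add ((hm z hzD a ha hB).trans hle)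
      (asianRate_le_varianceEnergy hadm))
  · apply ENNReal.le_of_forall_pos_le_add
    intro δ hδ _
    obtain ⟨z', hz', hz'0, hz'f, y, hy, hB, hval⟩ :=
      hp.exists_small_value hV₀ hz0 h0 hge (δ := δ) (by exact_mod_cast hδ)
    have hzD : z' ∈ D := (hD z').2 ⟨hz'0, hz'f, y, hB⟩
    obtain ⟨k, hk, hke⟩ := hadm.exists_truncation (σ := σ) hV₀ hz'
    have h1 : m z' ≤ δ := by
      refine (hm z' hzD y hy hB).trans ?_
      rw [← ENNReal.ofReal_coe_nnreal]
      exact ENNReal.ofReal_le_ofReal hval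
    have h2 : asianRate σ V₀ z' ≤ pathEnergy c r h + varianceEnergy σ h :=
      (asianRate_le_varianceEnergy hk).trans (hke.trans le_add_self)
    refine (iInf₂_le z' hzD).trans ?_
    rw [add_comm]
    exact add_le_add h2 h1

end Profile

/-! ### The logarithmic price coordinate. -/

/-- The price at signed logarithmic distance `r` from `S₀`, below for `ε = 1`, above for
`ε = -1`. -/
noncomputable def levelPrice (S₀ ε r : ℝ) : ℝ := S₀ * Real.exp (-(ε * r))

/-- The signed squared volatility in the logarithmic coordinate. -/
noncomputable def levelPotential (η : ℝ → ℝ) (S₀ ε r : ℝ) : ℝ := ε * η (levelPrice S₀ ε r) ^ 2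

/-- The metric density in the logarithmic coordinate. -/
noncomputable def levelDensity (η : ℝ → ℝ) (S₀ ε r : ℝ) : ℝ := 1 / η (levelPrice S₀ ε r)

section levelPrice

variable {S₀ ε : ℝ}

theorem levelPrice_pos (hS₀ : 0 < S₀) (r : ℝ) : 0 < levelPrice S₀ ε r :=
  mul_pos hS₀ (Real.exp_pos _)

theorem levelPrice_zero : levelPrice S₀ ε 0 = S₀ := by simp [levelPrice]

theorem hasDerivAt_levelPrice (r : ℝ) :
    HasDerivAt (levelPrice S₀ ε) (-ε * levelPrice S₀ ε r) r := by
  have := (((hasDerivAt_id r).const_mul ε).neg.exp).const_mul S₀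
  refine this.congr_deriv ?_
  simp only [levelPrice, id, Pi.neg_apply]
  ring

theorem continuous_levelPrice : Continuous (levelPrice S₀ ε) := by
  unfold levelPrice
  fun_prop

theorem exists_levelPrice_eq (hS₀ : 0 < S₀) (hε : ε = 1 ∨ ε = -1) {G : ℝ} (hG : 0 < G) :
    ∃ a, levelPrice S₀ ε a = G := by
  have hεε : ε * ε = 1 := by rcases hε with rfl | rfl <;> norm_num
  refine ⟨-ε * Real.log (G / S₀), ?_⟩
  have : -(ε * (-ε * Real.log (G / S₀))) = Real.log (G / S₀) := by
    linear_combination Real.log (G / S₀) * hεε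
  rw [levelPrice, this, Real.exp_log (by positivity)]
  field_simp

theorem strictAnti_levelPrice_one (hS₀ : 0 < S₀) : StrictAnti (levelPrice S₀ 1) := by
  intro x y hxy
  simp only [levelPrice, one_mul]
  gcongr

theorem strictMono_levelPrice_neg_one (hS₀ : 0 < S₀) : StrictMono (levelPrice S₀ (-1)) := by
  intro x y hxy
  simp only [levelPrice, neg_mul, one_mul, neg_neg]
  gcongr

theorem levelPrice_injective (hS₀ : 0 < S₀) (hε : ε = 1 ∨ ε = -1) :
    Function.Injective (levelPrice S₀ ε) := by
  rcases hε with rfl | rfl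
  · exact (strictAnti_levelPrice_one hS₀).injective
  · exact (strictMono_levelPrice_neg_one hS₀).injective

theorem image_levelPrice_Ioo (hS₀ : 0 < S₀) (hε : ε = 1 ∨ ε = -1) {a : ℝ} (ha : 0 < a) :
    levelPrice S₀ ε '' Ioo 0 a = uIoo S₀ (levelPrice S₀ ε a) := by
  rcases hε with rfl | rfl
  · have hm := strictAnti_levelPrice_one hS₀
    have h0 := levelPrice_zero (S₀ := S₀) (ε := 1)
    have hlt := hm ha
    rw [h0] at hlt
    rw [uIoo_of_ge hlt.le]
    apply Subset.antisymm
    · rintro _ ⟨r, hr, rfl⟩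
      exact ⟨hm hr.2, (hm hr.1).trans_eq h0⟩
    · have := intermediate_value_Ioo' ha.le (continuous_levelPrice (S₀ := S₀) (ε := 1)).continuousOn
      rwa [h0] at this
  · have hm := strictMono_levelPrice_neg_one hS₀
    have h0 := levelPrice_zero (S₀ := S₀) (ε := -1)
    have hlt := hm ha
    rw [h0] at hlt
    rw [uIoo_of_le hlt.le]
    apply Subset.antisymm
    · rintro _ ⟨r, hr, rfl⟩
      exact ⟨h0.symm.trans_lt (hm hr.1), hm hr.2⟩
    · have := intermediate_value_Ioo ha.le
        (continuous_levelPrice (S₀ := S₀) (ε := -1)).continuousOn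
      rwa [h0] at this

theorem abs_deriv_levelPrice (hS₀ : 0 < S₀) (hε : ε = 1 ∨ ε = -1) (r : ℝ) :
    |-ε * levelPrice S₀ ε r| = levelPrice S₀ ε r := by
  have := levelPrice_pos (ε := ε) hS₀ r
  rcases hε with h | h
  · rw [h] at this ⊢
    rw [abs_mul, abs_of_pos this]; simp
  · rw [h] at this ⊢
    rw [abs_mul, abs_of_pos this]; simp

/-- Change of variables through the image of the open interval, valid for an arbitrary F, so
singular endpoints need no separate limit. -/
theorem intervalIntegrable_levelPrice_iff (hS₀ : 0 < S₀) (hε : ε = 1 ∨ ε = -1) {a : ℝ}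
    (ha : 0 < a) (F : ℝ → ℝ) : IntervalIntegrable F volume S₀ (levelPrice S₀ ε a) ↔
      IntervalIntegrable (fun r => levelPrice S₀ ε r * F (levelPrice S₀ ε r)) volume 0 a := by
  have h1 := integrableOn_image_iff_integrableOn_abs_deriv_smul (s := Ioo 0 a) measurableSet_Ioo
    (fun x _ => (hasDerivAt_levelPrice (S₀ := S₀) (ε := ε) x).hasDerivWithinAt)
    (levelPrice_injective hS₀ hε).injOn F
  simp only [abs_deriv_levelPrice hS₀ hε, smul_eq_mul] at h1
  rw [intervalIntegrable_iff_integrableOn_Ioo_of_le ha.le, ← h1, image_levelPrice_Ioo hS₀ hε ha]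
  rcases le_total S₀ (levelPrice S₀ ε a) with h | h
  · rw [intervalIntegrable_iff_integrableOn_Ioo_of_le h, uIoo_of_le h]
  · rw [intervalIntegrable_iff, uIoc_of_ge h, uIoo_of_ge h, integrableOn_Ioc_iff_integrableOn_Ioo]

theorem integral_levelPrice (hS₀ : 0 < S₀) (hε : ε = 1 ∨ ε = -1) {a : ℝ}
    (ha : 0 < a) (F : ℝ → ℝ) : ∫ x in S₀..levelPrice S₀ ε a, F x =
      -ε * ∫ r in (0 : ℝ)..a, levelPrice S₀ ε r * F (levelPrice S₀ ε r) := by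
  have h1 := integral_image_eq_integral_abs_deriv_smul (s := Ioo 0 a) measurableSet_Ioo
    (fun x _ => (hasDerivAt_levelPrice (S₀ := S₀) (ε := ε) x).hasDerivWithinAt)
    (levelPrice_injective hS₀ hε).injOn F
  simp only [abs_deriv_levelPrice hS₀ hε, smul_eq_mul] at h1
  rw [integral_of_le ha.le, integral_Ioc_eq_integral_Ioo, ← h1, image_levelPrice_Ioo hS₀ hε ha]
  have h0 := levelPrice_zero (S₀ := S₀) (ε := ε)
  rcases hε with h | h
  · rw [h] at h0 ⊢
    have := strictAnti_levelPrice_one hS₀ ha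
    rw [h0] at this
    rw [integral_of_ge this.le, uIoo_of_ge this.le, integral_Ioc_eq_integral_Ioo]
    ring
  · rw [h] at h0 ⊢
    have := strictMono_levelPrice_neg_one hS₀ ha
    rw [h0] at this
    rw [integral_of_le this.le, uIoo_of_le this.le, integral_Ioc_eq_integral_Ioo]
    ring

end levelPrice

/-- Near a critical point a function with locally Lipschitz derivative varies quadratically. -/
theorem isBigO_sq_of_deriv_eq_zero {η : ℝ → ℝ} (hd : DifferentiableOn ℝ η (Ioi 0))
    (hL : LocallyLipschitzOn (Ioi 0) (deriv η)) {x₀ : ℝ} (hx₀ : 0 < x₀) (h0 : deriv η x₀ = 0) :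
    (fun x => η x - η x₀) =O[𝓝 x₀] (fun x => (x - x₀) ^ 2) := by
  obtain ⟨L, t, ht, hLt⟩ := hL hx₀
  rw [isOpen_Ioi.nhdsWithin_eq hx₀] at ht
  obtain ⟨δ, hδ, hball⟩ := Metric.mem_nhds_iff.1 (inter_mem ht (Ioi_mem_nhds hx₀))
  have hx₀t := (hball (Metric.mem_ball_self hδ)).1
  apply IsBigO.of_bound L
  filter_upwards [Metric.ball_mem_nhds x₀ hδ] with x hx
  have hsub : uIcc x₀ x ⊆ Metric.ball x₀ δ :=
    (convex_ball x₀ δ).ordConnected.uIcc_subset (Metric.mem_ball_self hδ) hx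
  have hb : ∀ y ∈ uIcc x₀ x, ‖deriv η y‖ ≤ L * |x - x₀| := by
    intro y hy
    have := hLt.dist_le_mul y (hball (hsub hy)).1 x₀ hx₀t
    rw [h0, dist_zero_right] at this
    refine this.trans ?_
    gcongr
    rw [Real.dist_eq]
    exact abs_sub_left_of_mem_uIcc hy
  have := Convex.norm_image_sub_le_of_norm_deriv_le (f := η) (s := uIcc x₀ x)
    (fun y hy => hd.differentiableAt (Ioi_mem_nhds (hball (hsub hy)).2)) hb (convex_uIcc _ _)
    left_mem_uIcc right_mem_uIcc
  refine this.trans (le_of_eq ?_)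
  rw [norm_pow, Real.norm_eq_abs]
  ring

section

variable {η : ℝ → ℝ} {S₀ ε : ℝ}

/-- For `regular`, critical points of η give the quadratic alternative through the Lipschitz bound
on η'; elsewhere f has nonzero derivative and the linear alternative holds. -/
theorem profile_level (hS₀ : 0 < S₀) (hε : ε = 1 ∨ ε = -1)
    (hη_upper : ∃ M : ℝ, ∀ x > 0, η x ≤ M) (hη_lower : ∃ m > 0, ∀ x > 0, m ≤ η x)
    (hη_anti : StrictAntiOn η (Set.Ioi 0)) (hη_diff : DifferentiableOn ℝ η (Set.Ioi 0))
    (hη_deriv : LocallyLipschitzOn (Set.Ioi 0) (deriv η)) :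
    Profile (levelPotential η S₀ ε) (levelDensity η S₀ ε) := by
  obtain ⟨M, hM⟩ := hη_upper
  obtain ⟨m, hm, hmη⟩ := hη_lower
  have hpos : ∀ r, 0 < η (levelPrice S₀ ε r) := fun r => hm.trans_le (hmη _ (levelPrice_pos hS₀ r))
  have hle : ∀ r, η (levelPrice S₀ ε r) ≤ M := fun r => hM _ (levelPrice_pos hS₀ r)
  have hMpos : 0 < M := (hpos 0).trans_le (hle 0)
  have hcont : Continuous fun r => η (levelPrice S₀ ε r) :=
    hη_diff.continuousOn.comp_continuous continuous_levelPrice fun r => levelPrice_pos hS₀ r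
  constructor
  · intro r s hrs
    unfold levelPotential
    rcases hε with h | h
    · have h1 := strictAnti_levelPrice_one hS₀ hrs
      rw [← h] at h1
      have h2 := hη_anti (levelPrice_pos hS₀ s) (levelPrice_pos hS₀ r) h1
      have h3 := hpos r
      rw [h] at h2 h3 ⊢
      rw [one_mul, one_mul]
      gcongr
    · have h1 := strictMono_levelPrice_neg_one hS₀ hrs
      rw [← h] at h1
      have h2 := hη_anti (levelPrice_pos hS₀ r) (levelPrice_pos hS₀ s) h1
      have h3 := hpos s
      rw [h] at h2 h3 ⊢
      rw [neg_one_mul, neg_one_mul, neg_lt_neg_iff]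
      gcongr
  · exact (hcont.pow 2).const_mul ε
  · exact continuous_const.div hcont fun r => (hpos r).ne'
  · exact ⟨1 / M, by positivity, fun r => one_div_le_one_div_of_le (hpos r) (hle r)⟩
  · refine ⟨M ^ 2, ?_⟩
    rintro _ ⟨r, rfl⟩
    have h1 : η (levelPrice S₀ ε r) ^ 2 ≤ M ^ 2 := by
      have := (hpos r).le
      have := hle r
      gcongr
    have h2 := sq_nonneg (η (levelPrice S₀ ε r))
    simp only [levelPotential]
    rcases hε with h | h
    · nlinarith
    · nlinarith
  · intro a
    set x₀ := levelPrice S₀ ε a with hx₀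
    have hx₀0 : 0 < x₀ := levelPrice_pos hS₀ a
    by_cases h0 : deriv η x₀ = 0
    · left
      have h1 := isBigO_sq_of_deriv_eq_zero hη_diff hη_deriv hx₀0 h0
      have h2 := h1.comp_tendsto (continuous_levelPrice (S₀ := S₀) (ε := ε)).continuousAt
      have h3 := h2.trans ((hasDerivAt_levelPrice (S₀ := S₀) (ε := ε) a).isBigO_sub.pow 2)
      have h4 : (fun r => ε * (η (levelPrice S₀ ε r) + η x₀)) =O[𝓝 a] (fun _ => (1 : ℝ)) :=
        (((hcont.add continuous_const).const_mul ε).tendsto a).isBigO_one ℝ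
      refine (h4.mul h3).congr (fun r => ?_) (fun r => by simp)
      simp only [Function.comp_apply, levelPotential]
      ring
    · right
      have hd := (hη_diff.differentiableAt (Ioi_mem_nhds hx₀0)).hasDerivAt
      have h1 := ((hd.comp a (hasDerivAt_levelPrice (S₀ := S₀) (ε := ε) a)).pow 2).const_mul ε
      have hne : ε * (((2 : ℕ) : ℝ) * (η ∘ levelPrice S₀ ε) a ^ (2 - 1) *
          (deriv η x₀ * (-ε * levelPrice S₀ ε a))) ≠ 0 := by
        have hε0 : ε ≠ 0 := by rcases hε with h | h <;> rw [h] <;> norm_num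
        exact mul_ne_zero hε0 (mul_ne_zero (mul_ne_zero two_ne_zero (pow_ne_zero _ (hpos a).ne'))
          (mul_ne_zero h0 (mul_ne_zero (neg_ne_zero.2 hε0) hx₀0.ne')))
      exact (HasDerivAtFilter.isTheta_sub h1 hne).isBigO_symm.comp_tendsto
        (tendsto_id.prodMk tendsto_const_pure)

end

/-! ### Translation of the option problem and conclusion. -/

section

variable {η σ : ℝ → ℝ} {S₀ V₀ K ε z a : ℝ}

theorem mul_self_eq_one_of_sign (hε : ε = 1 ∨ ε = -1) : ε * ε = 1 := by
  rcases hε with rfl | rfl <;> norm_num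

theorem levelPotential_sub (a r : ℝ) : levelPotential η S₀ ε a - levelPotential η S₀ ε r =
    ε * (η (levelPrice S₀ ε a) ^ 2 - η (levelPrice S₀ ε r) ^ 2) := by
  simp only [levelPotential]
  ring

theorem price_num_integrand (hS₀ : 0 < S₀) (r : ℝ) :
    levelPrice S₀ ε r * (1 / (levelPrice S₀ ε r * η (levelPrice S₀ ε r) *
      √(ε * (η (levelPrice S₀ ε a) ^ 2 - η (levelPrice S₀ ε r) ^ 2)))) =
    levelDensity η S₀ ε r / √(levelPotential η S₀ ε a - levelPotential η S₀ ε r) := by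
  have := (levelPrice_pos (ε := ε) hS₀ r).ne'
  rw [levelPotential_sub, levelDensity, mul_assoc (levelPrice S₀ ε r), mul_one_div,
    mul_comm (levelPrice S₀ ε r), div_mul_cancel_right₀ this, div_div, one_div]

theorem price_den_integrand (hS₀ : 0 < S₀) (hε : ε = 1 ∨ ε = -1) (hη : ∀ x > 0, 0 < η x) (r : ℝ) :
    levelPrice S₀ ε r * (η (levelPrice S₀ ε r) / (levelPrice S₀ ε r *
      √(ε * (η (levelPrice S₀ ε a) ^ 2 - η (levelPrice S₀ ε r) ^ 2)))) =
    ε * (levelDensity η S₀ ε r * levelPotential η S₀ ε r /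
      √(levelPotential η S₀ ε a - levelPotential η S₀ ε r)) := by
  have h1 := (levelPrice_pos (ε := ε) hS₀ r).ne'
  have h2 := (hη _ (levelPrice_pos (ε := ε) hS₀ r)).ne'
  have h3 : levelDensity η S₀ ε r * levelPotential η S₀ ε r = ε * η (levelPrice S₀ ε r) := by
    simp only [levelDensity, levelPotential]
    field_simp
  rw [levelPotential_sub, h3, ← mul_div_assoc, mul_div_mul_left _ _ h1, ← mul_div_assoc,
    ← mul_assoc, mul_self_eq_one_of_sign hε, one_mul]

/-- The substitution turns the numerator into T and the denominator into ε times the weighted time,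
up to a common factor -ε. Both are positive, which forces z > 0. -/
theorem solves_iff_isExtremal (hp : Profile (levelPotential η S₀ ε) (levelDensity η S₀ ε))
    (hS₀ : 0 < S₀) (hK : 0 < K) (hε : ε = 1 ∨ ε = -1) (hη : ∀ x > 0, 0 < η x) (ha : 0 < a) :
    (IntervalIntegrable (fun x => 1 / (x * η x * √(ε * (η (levelPrice S₀ ε a) ^ 2 - η x ^ 2))))
        volume S₀ (levelPrice S₀ ε a) ∧
      IntervalIntegrable (fun x => η x / (x * √(ε * (η (levelPrice S₀ ε a) ^ 2 - η x ^ 2))))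
        volume S₀ (levelPrice S₀ ε a) ∧
      (∫ x in S₀..levelPrice S₀ ε a,
          1 / (x * η x * √(ε * (η (levelPrice S₀ ε a) ^ 2 - η x ^ 2)))) /
        (∫ x in S₀..levelPrice S₀ ε a,
          η x / (x * √(ε * (η (levelPrice S₀ ε a) ^ 2 - η x ^ 2)))) = z / K) ↔
    0 < z ∧ IsExtremal (levelPotential η S₀ ε) (levelDensity η S₀ ε) z (ε * K) a := by
  have hεε := mul_self_eq_one_of_sign hε
  rw [intervalIntegrable_levelPrice_iff hS₀ hε ha, intervalIntegrable_levelPrice_iff hS₀ hε ha,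
    integral_levelPrice hS₀ hε ha, integral_levelPrice hS₀ hε ha]
  simp only [price_num_integrand hS₀, price_den_integrand hS₀ hε hη,
    intervalIntegral.integral_const_mul]
  change _ ∧ _ ∧ (-ε * travelTime (levelPotential η S₀ ε) (levelDensity η S₀ ε) a) /
    (-ε * (ε * weightedTime (levelPotential η S₀ ε) (levelDensity η S₀ ε) a)) = z / K ↔ _
  set T := travelTime (levelPotential η S₀ ε) (levelDensity η S₀ ε) a with hT
  set P := weightedTime (levelPotential η S₀ ε) (levelDensity η S₀ ε) a with hP
  have hε0 : -ε ≠ 0 := by rcases hε with h | h <;> rw [h] <;> norm_num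
  rw [mul_div_mul_left _ _ hε0]
  have pos : IntervalIntegrable (fun r => levelDensity η S₀ ε r /
      √(levelPotential η S₀ ε a - levelPotential η S₀ ε r)) volume 0 a →
      0 < T ∧ 0 < ε * P := by
    intro hi
    refine ⟨hp.travelTime_pos ha hi, ?_⟩
    rw [hP, weightedTime, ← intervalIntegral.integral_const_mul]
    apply intervalIntegral_pos_of_pos_on ((hp.weighted_intervalIntegrable hi).const_mul ε) _ ha
    intro r hr
    rw [← price_den_integrand hS₀ hε hη, ← levelPotential_sub]
    have h1 := levelPrice_pos (ε := ε) hS₀ r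
    have h2 := hη _ h1
    have h3 := Real.sqrt_pos.2 (sub_pos.2 (hp.mono hr.2))
    positivity
  constructor
  · rintro ⟨hi, -, he⟩
    obtain ⟨hT0, hP0⟩ := pos hi
    rw [div_eq_div_iff hP0.ne' hK.ne'] at he
    refine ⟨?_, ha, hi, ?_⟩
    · have : 0 < z * (ε * P) := by rw [← he]; positivity
      exact (mul_pos_iff_of_pos_right hP0).1 this
    · change T * (ε * K) = z * P
      linear_combination ε * he + z * P * hεε
  · rintro ⟨-, -, hi, he⟩
    obtain ⟨hT0, hP0⟩ := pos hi
    refine ⟨hi, (hp.weighted_intervalIntegrable hi).const_mul ε, ?_⟩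
    rw [div_eq_div_iff hP0.ne' hK.ne']
    change T * (ε * K) = z * P at he
    linear_combination ε * he - T * K * hεε

theorem price_term_eq (hp : Profile (levelPotential η S₀ ε) (levelDensity η S₀ ε))
    (hS₀ : 0 < S₀) (hK : 0 < K) (hε : ε = 1 ∨ ε = -1) (hη : ∀ x > 0, 0 < η x) (hz : 0 < z)
    (hex : IsExtremal (levelPotential η S₀ ε) (levelDensity η S₀ ε) z (ε * K) a) :
    1 / K ^ 2 * (∫ x in S₀..levelPrice S₀ ε a,
        η x / (x * √(2 * (ε * (η (levelPrice S₀ ε a) ^ 2 - η x ^ 2))))) ^ 2 *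
      (ε * (η (levelPrice S₀ ε a) ^ 2 * z - K)) =
    travelCost (levelPotential η S₀ ε) (levelDensity η S₀ ε) a ^ 2 /
      (2 * (z * levelPotential η S₀ ε a - ε * K)) := by
  have hεε := mul_self_eq_one_of_sign hε
  have hε0 : ε ≠ 0 := by rcases hε with h | h <;> rw [h] <;> norm_num
  rw [← hex.value_eq hp hz (mul_ne_zero hε0 hK.ne'), integral_levelPrice hS₀ hε hex.pos]
  have e : ∀ r, levelPrice S₀ ε r * (η (levelPrice S₀ ε r) / (levelPrice S₀ ε r *
      √(2 * (ε * (η (levelPrice S₀ ε a) ^ 2 - η (levelPrice S₀ ε r) ^ 2))))) =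
      ε / √2 * (levelDensity η S₀ ε r * levelPotential η S₀ ε r /
        √(levelPotential η S₀ ε a - levelPotential η S₀ ε r)) := by
    intro r
    rw [div_mul_eq_mul_div, ← price_den_integrand hS₀ hε hη, Real.sqrt_mul (by norm_num)]
    ring
  simp only [e, intervalIntegral.integral_const_mul]
  change 1 / K ^ 2 * (-ε * (ε / √2 * weightedTime _ _ a)) ^ 2 * _ = _
  have h2 : √2 ^ 2 = (2 : ℝ) := Real.sq_sqrt (by norm_num)
  have hε2 : ε ^ 2 = 1 := by rw [sq, hεε]
  rw [mul_pow, mul_pow, div_pow, h2, neg_sq, mul_pow ε K, hε2, levelPotential]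
  ring

theorem action_eq (hS₀ : 0 < S₀) (hε : ε = 1 ∨ ε = -1) (r h : ℝ → ℝ) :
    action η σ 0 (fun t => Real.log S₀ - ε * r t) h =
      pathEnergy (levelDensity η S₀ ε) r h + varianceEnergy σ h := by
  unfold action pathEnergy varianceEnergy
  have e : ENNReal.ofReal (1 / (2 * (1 - (0 : ℝ) ^ 2))) = ENNReal.ofReal (1 / 2) := by norm_num
  rw [e]
  congr 2
  apply lintegral_congr
  intro t
  congr 1
  have hx : Real.exp (Real.log S₀ - ε * r t) = levelPrice S₀ ε (r t) := by
    rw [levelPrice, sub_eq_add_neg, Real.exp_add, Real.exp_log hS₀]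
  rw [hx, deriv_const_sub, deriv_const_mul_field, zero_mul, zero_div, sub_zero, levelDensity]
  have hε2 : ε ^ 2 = 1 := by rw [sq, mul_self_eq_one_of_sign hε]
  calc _ = ε ^ 2 * (1 / η (levelPrice S₀ ε (r t)) * deriv r t / √(Real.exp (h t))) ^ 2 := by
        rw [← mul_pow, ← neg_sq (ε * _)]
        congr 1
        rw [div_mul_eq_div_div]
        ring
    _ = _ := by rw [hε2, one_mul]

theorem admissiblePair_iff (hS₀ : 0 < S₀) (hε : ε = 1 ∨ ε = -1) (r h : ℝ → ℝ) :
    AdmissiblePair η S₀ V₀ K (fun t => Real.log S₀ - ε * r t) h ↔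
      AbsolutelyContinuousOnInterval r 0 1 ∧ AbsolutelyContinuousOnInterval h 0 1 ∧ r 0 = 0 ∧
      h 0 = Real.log V₀ ∧
      ∫ t in (0 : ℝ)..1, Real.exp (h t) * levelPotential η S₀ ε (r t) = ε * K := by
  have hεε := mul_self_eq_one_of_sign hε
  have hε0 : ε ≠ 0 := by rcases hε with h | h <;> rw [h] <;> norm_num
  have hconst : AbsolutelyContinuousOnInterval (fun _ : ℝ => Real.log S₀) 0 1 :=
    ((LipschitzWith.const (Real.log S₀)).lipschitzOnWith).absolutelyContinuousOnInterval
  have hx : ∀ t, Real.exp (Real.log S₀ - ε * r t) = levelPrice S₀ ε (r t) := fun t => by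
    rw [levelPrice, sub_eq_add_neg, Real.exp_add, Real.exp_log hS₀]
  have hint : ∫ t in (0 : ℝ)..1, Real.exp (h t) * levelPotential η S₀ ε (r t) =
      ε * ∫ t in (0 : ℝ)..1, Real.exp (h t) * η (levelPrice S₀ ε (r t)) ^ 2 := by
    rw [← intervalIntegral.integral_const_mul]
    congr 1
    ext t
    simp only [levelPotential]
    ring
  rw [hint]
  constructor
  · rintro ⟨h1, h2, h3, h4, h5⟩
    refine ⟨?_, h2, ?_, h4, ?_⟩
    · have := (hconst.sub h1).const_mul ε
      convert this using 1
      ext t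
      simp only [Pi.sub_apply]
      linear_combination (-r t) * hεε
    · have : ε * r 0 = 0 := by linarith
      exact (mul_eq_zero.1 this).resolve_left hε0
    · simp only [hx] at h5
      rw [h5]
  · rintro ⟨h1, h2, h3, h4, h5⟩
    refine ⟨hconst.sub (h1.const_mul ε), h2, by simp [h3], h4, ?_⟩
    simp only [hx]
    exact mul_left_cancel₀ hε0 h5

/-- For ≤, each variance path is paired with the extremal path run along its clock; for ≥,
`iInf_le_energy` applies to every admissible pair. -/
theorem rateFunction_eq_iInf
    (hp : Profile (levelPotential η S₀ ε) (levelDensity η S₀ ε))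
    (hS₀ : 0 < S₀) (hV₀ : 0 < V₀) (hε : ε = 1 ∨ ε = -1)
    (h0 : V₀ * levelPotential η S₀ ε 0 < ε * K) {D : Set ℝ}
    (hD : ∀ z, z ∈ D ↔ 0 < z ∧ z * levelPotential η S₀ ε 0 < ε * K ∧
      ∃ b, ε * K < z * levelPotential η S₀ ε b) {m : ℝ → ℝ}
    (hex : ∀ z ∈ D, ∃ a, IsExtremal (levelPotential η S₀ ε) (levelDensity η S₀ ε) z (ε * K) a ∧
      m z = travelCost (levelPotential η S₀ ε) (levelDensity η S₀ ε) a ^ 2 /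
        (2 * (z * levelPotential η S₀ ε a - ε * K)))
    (hm : ∀ z ∈ D, ∀ y > 0, ε * K < z * levelPotential η S₀ ε y →
      m z ≤ travelCost (levelPotential η S₀ ε) (levelDensity η S₀ ε) y ^ 2 /
        (2 * (z * levelPotential η S₀ ε y - ε * K))) :
    (rateFunction η σ 0 S₀ V₀ K : EReal) =
      ⨅ z ∈ D, ((m z : ℝ) : EReal) + (asianRate σ V₀ z : EReal) := by
  have hεε := mul_self_eq_one_of_sign hε
  have hm0 : ∀ z ∈ D, 0 ≤ m z := by
    intro z hz
    obtain ⟨a, ha, he⟩ := hex z hz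
    rw [he]
    have := sub_pos.2 (ha.lt_mul hp ((hD z).1 hz).1)
    positivity
  have hcoe : ∀ z ∈ D, ((m z : ℝ) : EReal) + (asianRate σ V₀ z : EReal) =
      ((ENNReal.ofReal (m z) + asianRate σ V₀ z : ℝ≥0∞) : EReal) := by
    intro z hz
    rw [EReal.coe_ennreal_add, EReal.coe_ennreal_ofReal, max_eq_left (hm0 z hz)]
  have hkey : rateFunction η σ 0 S₀ V₀ K = ⨅ z ∈ D, (ENNReal.ofReal (m z) + asianRate σ V₀ z) := by
    apply le_antisymm
    · refine le_iInf₂ fun z hz => ?_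
      obtain ⟨a, ha, he⟩ := hex z hz
      unfold asianRate
      simp only [ENNReal.add_iInf]
      refine le_iInf₂ fun h hh => ?_
      have hc : ContinuousOn h (Icc 0 1) := by
        have := hh.ac_h.continuousOn
        rwa [uIcc_of_le zero_le_one] at this
      obtain ⟨r, h1, h2, h3, h4⟩ := ha.exists_path hp hc hh.constraint
      rw [he, ← h4]
      refine (iInf₂_le_of_le (fun t => Real.log S₀ - ε * r t) h (iInf_le_of_le ?_ ?_))
      · exact (admissiblePair_iff hS₀ hε r h).2 ⟨h1, hh.ac_h, h2, hh.h_zero, h3⟩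
      · exact (action_eq hS₀ hε r h).le
    · refine le_iInf₂ fun g h => le_iInf fun hg => ?_
      -- Since ε² = 1, every log-price path has the form log S₀ - εr.
      have e : g = fun t => Real.log S₀ - ε * (ε * (Real.log S₀ - g t)) := by
        ext t
        linear_combination (Real.log S₀ - g t) * hεε
      rw [e] at hg ⊢
      obtain ⟨h1, h2, h3, h4, h5⟩ := (admissiblePair_iff hS₀ hε _ h).1 hg
      rw [action_eq hS₀ hε]
      exact hp.iInf_le_energy hV₀ h0 hD
        (fun z hz y hy hB => ENNReal.ofReal_le_ofReal (hm z hz y hy hB)) h1 h3 h2 h4 h5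
  rw [hkey]
  apply le_antisymm
  · refine le_iInf₂ fun z hz => ?_
    rw [hcoe z hz, EReal.coe_ennreal_le_coe_ennreal_iff]
    exact iInf₂_le z hz
  · have hnn : (0 : EReal) ≤ ⨅ z ∈ D, ((m z : ℝ) : EReal) + (asianRate σ V₀ z : EReal) := by
      refine le_iInf₂ fun z hz => ?_
      rw [hcoe z hz]
      exact EReal.coe_ennreal_nonneg _
    rw [← EReal.coe_toENNReal hnn, EReal.coe_ennreal_le_coe_ennreal_iff]
    refine le_iInf₂ fun z hz => ?_
    rw [← EReal.coe_ennreal_le_coe_ennreal_iff, EReal.coe_toENNReal hnn, ← hcoe z hz]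
    exact iInf₂_le z hz

/-- The reduction of the rate function, for an out-of-the-money option of either type. -/
theorem exists_optimal_price
    (hp : Profile (levelPotential η S₀ ε) (levelDensity η S₀ ε))
    (hS₀ : 0 < S₀) (hV₀ : 0 < V₀) (hK : 0 < K) (hε : ε = 1 ∨ ε = -1) (hη : ∀ x > 0, 0 < η x)
    (h0 : V₀ * levelPotential η S₀ ε 0 < ε * K) {D : Set ℝ}
    (hD : ∀ z, z ∈ D ↔ 0 < z ∧ z * levelPotential η S₀ ε 0 < ε * K ∧
      ∃ b, ε * K < z * levelPotential η S₀ ε b) {Solves : ℝ → ℝ → Prop} {term : ℝ → ℝ → ℝ}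
    (hsol : ∀ z G, Solves z G ↔ 0 < z ∧ ∃ a, levelPrice S₀ ε a = G ∧
      IsExtremal (levelPotential η S₀ ε) (levelDensity η S₀ ε) z (ε * K) a)
    (hterm : ∀ z G, term z G = 1 / K ^ 2 * (∫ x in S₀..G,
        η x / (x * √(2 * (ε * (η G ^ 2 - η x ^ 2))))) ^ 2 * (ε * (η G ^ 2 * z - K))) :
    (∀ z : ℝ, z ∈ D ↔ ∃ G : ℝ, Solves z G) ∧
      ∃ Gc : ℝ → ℝ,
        (∀ z ∈ D, Solves z (Gc z) ∧ ∀ G : ℝ, Solves z G → term z (Gc z) ≤ term z G) ∧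
        (rateFunction η σ 0 S₀ V₀ K : EReal) =
          ⨅ z ∈ D, ((term z (Gc z) : ℝ) : EReal) + (asianRate σ V₀ z : EReal) := by
  have hval : ∀ z a, 0 < z →
      IsExtremal (levelPotential η S₀ ε) (levelDensity η S₀ ε) z (ε * K) a →
      term z (levelPrice S₀ ε a) =
        travelCost (levelPotential η S₀ ε) (levelDensity η S₀ ε) a ^ 2 /
          (2 * (z * levelPotential η S₀ ε a - ε * K)) := fun z a hz ha => by
    rw [hterm, price_term_eq hp hS₀ hK hε hη hz ha]
  have hopt : ∀ z, ∃ a, z ∈ D →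
      IsExtremal (levelPotential η S₀ ε) (levelDensity η S₀ ε) z (ε * K) a ∧
      ∀ y > 0, ε * K < z * levelPotential η S₀ ε y →
        travelCost (levelPotential η S₀ ε) (levelDensity η S₀ ε) a ^ 2 /
          (2 * (z * levelPotential η S₀ ε a - ε * K)) ≤
        travelCost (levelPotential η S₀ ε) (levelDensity η S₀ ε) y ^ 2 /
          (2 * (z * levelPotential η S₀ ε y - ε * K)) := by
    intro z
    by_cases hz : z ∈ D
    · obtain ⟨h1, h2, b, hb⟩ := (hD z).1 hz
      obtain ⟨a, ha⟩ := hp.exists_isExtremal h1 h2 hb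
      exact ⟨a, fun _ => ha⟩
    · exact ⟨0, fun h => absurd h hz⟩
  choose α hα using hopt
  refine ⟨fun z => ⟨fun hz => ?_, ?_⟩, fun z => levelPrice S₀ ε (α z), fun z hz => ⟨?_, ?_⟩, ?_⟩
  · exact ⟨_, (hsol z _).2 ⟨((hD z).1 hz).1, α z, rfl, (hα z hz).1⟩⟩
  · rintro ⟨G, hG⟩
    obtain ⟨hz, a, -, ha⟩ := (hsol z G).1 hG
    exact (hD z).2 ⟨hz, ha.mul_lt hp hz, a, ha.lt_mul hp hz⟩
  · exact (hsol z _).2 ⟨((hD z).1 hz).1, α z, rfl, (hα z hz).1⟩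
  · intro G hG
    obtain ⟨hz0, a, rfl, ha⟩ := (hsol z G).1 hG
    rw [hval z _ hz0 (hα z hz).1, hval z a hz0 ha]
    exact (hα z hz).2 a ha.pos (ha.lt_mul hp hz0)
  · refine rateFunction_eq_iInf hp hS₀ hV₀ hε h0 hD (fun z hz => ?_) (fun z hz y hy hB => ?_)
    · exact ⟨α z, (hα z hz).1, hval z _ ((hD z).1 hz).1 (hα z hz).1⟩
    · rw [hval z _ ((hD z).1 hz).1 (hα z hz).1]
      exact (hα z hz).2 y hy hB

theorem solvesCall_iff (hp : Profile (levelPotential η S₀ 1) (levelDensity η S₀ 1))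
    (hS₀ : 0 < S₀) (hK : 0 < K) (hη : ∀ x > 0, 0 < η x) (z G : ℝ) :
    SolvesCall η S₀ K z G ↔ 0 < z ∧ ∃ a, levelPrice S₀ 1 a = G ∧
      IsExtremal (levelPotential η S₀ 1) (levelDensity η S₀ 1) z (1 * K) a := by
  have key := fun a (ha : 0 < a) => solves_iff_isExtremal (a := a) (z := z) hp hS₀ hK
    (Or.inl rfl) hη ha
  simp only [one_mul] at key ⊢
  constructor
  · rintro ⟨h1, h2, h3, h4, h5⟩
    obtain ⟨a, rfl⟩ := exists_levelPrice_eq hS₀ (Or.inl rfl) h1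
    have ha : 0 < a := by
      rw [← (strictAnti_levelPrice_one hS₀).lt_iff_gt, levelPrice_zero]
      exact h2
    obtain ⟨hz, hex⟩ := (key a ha).1 ⟨h3, h4, h5⟩
    exact ⟨hz, a, rfl, hex⟩
  · rintro ⟨hz, a, rfl, hex⟩
    obtain ⟨h3, h4, h5⟩ := (key a hex.pos).2 ⟨hz, hex⟩
    have hlt := strictAnti_levelPrice_one hS₀ hex.pos
    rw [levelPrice_zero] at hlt
    exact ⟨levelPrice_pos hS₀ a, hlt, h3, h4, h5⟩

theorem solvesPut_iff (hp : Profile (levelPotential η S₀ (-1)) (levelDensity η S₀ (-1)))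
    (hS₀ : 0 < S₀) (hK : 0 < K) (hη : ∀ x > 0, 0 < η x) (z G : ℝ) :
    SolvesPut η S₀ K z G ↔ 0 < z ∧ ∃ a, levelPrice S₀ (-1) a = G ∧
      IsExtremal (levelPotential η S₀ (-1)) (levelDensity η S₀ (-1)) z (-1 * K) a := by
  have key := fun a (ha : 0 < a) => solves_iff_isExtremal (a := a) (z := z) hp hS₀ hK
    (Or.inr rfl) hη ha
  simp only [neg_one_mul, neg_sub] at key ⊢
  constructor
  · rintro ⟨h2, h3, h4, h5⟩
    obtain ⟨a, rfl⟩ := exists_levelPrice_eq hS₀ (Or.inr rfl) (hS₀.trans h2)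
    have ha : 0 < a := by
      rw [← (strictMono_levelPrice_neg_one hS₀).lt_iff_lt, levelPrice_zero]
      exact h2
    obtain ⟨hz, hex⟩ := (key a ha).1 ⟨h3, h4, h5⟩
    exact ⟨hz, a, rfl, hex⟩
  · rintro ⟨hz, a, rfl, hex⟩
    obtain ⟨h3, h4, h5⟩ := (key a hex.pos).2 ⟨hz, hex⟩
    have hlt := strictMono_levelPrice_neg_one hS₀ hex.pos
    rw [levelPrice_zero] at hlt
    exact ⟨hlt, h3, h4, h5⟩

theorem mem_callDomain_iff (hS₀ : 0 < S₀) (hK : 0 < K) (hη : ∀ x > 0, 0 < η x) (z : ℝ) :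
    z ∈ callDomain η S₀ K ↔ 0 < z ∧ z * levelPotential η S₀ 1 0 < 1 * K ∧
      ∃ b, 1 * K < z * levelPotential η S₀ 1 b := by
  have h0 := hη S₀ hS₀
  simp only [callDomain, mem_ofPred_eq, levelPotential, one_mul, levelPrice_zero]
  rw [lt_div_iff₀ (by positivity)]
  constructor
  · rintro ⟨⟨x, hx, h1⟩, h2⟩
    obtain ⟨b, rfl⟩ := exists_levelPrice_eq hS₀ (Or.inl rfl) hx
    have := hη _ hx
    exact ⟨lt_trans (by positivity) h1, h2, b, (div_lt_iff₀ (by positivity)).1 h1⟩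
  · rintro ⟨-, h2, b, hb⟩
    have := hη _ (levelPrice_pos (ε := 1) hS₀ b)
    exact ⟨⟨_, levelPrice_pos hS₀ b, (div_lt_iff₀ (by positivity)).2 hb⟩, h2⟩

theorem mem_putDomain_iff (hS₀ : 0 < S₀) (hK : 0 < K) (hη : ∀ x > 0, 0 < η x) (z : ℝ) :
    z ∈ putDomain η S₀ K ↔ 0 < z ∧ z * levelPotential η S₀ (-1) 0 < -1 * K ∧
      ∃ b, -1 * K < z * levelPotential η S₀ (-1) b := by
  have h0 := hη S₀ hS₀
  simp only [putDomain, mem_ofPred_eq, levelPotential, neg_one_mul, mul_neg, neg_lt_neg_iff,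
    levelPrice_zero]
  constructor
  · rintro ⟨h2, x, hx, h1⟩
    obtain ⟨b, rfl⟩ := exists_levelPrice_eq hS₀ (Or.inr rfl) hx
    have := hη _ hx
    exact ⟨lt_trans (by positivity) h2, (div_lt_iff₀ (by positivity)).1 h2, b,
      (lt_div_iff₀ (by positivity)).1 h1⟩
  · rintro ⟨-, h2, b, hb⟩
    have := hη _ (levelPrice_pos (ε := -1) hS₀ b)
    exact ⟨(div_lt_iff₀ (by positivity)).2 h2, _, levelPrice_pos hS₀ b,
      (lt_div_iff₀ (by positivity)).2 hb⟩

end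

theorem proposition1
    (η σ : ℝ → ℝ) (S₀ V₀ K : ℝ) (hS₀ : 0 < S₀) (hV₀ : 0 < V₀) (hK : 0 < K)
    (hη_upper : ∃ M : ℝ, ∀ x > 0, η x ≤ M)
    (hη_lower : ∃ m > 0, ∀ x > 0, m ≤ η x)
    (hη_anti : StrictAntiOn η (Set.Ioi 0))
    (hη_diff : DifferentiableOn ℝ η (Set.Ioi 0))
    (hη_deriv : LocallyLipschitzOn (Set.Ioi 0) (deriv η))
    (hσ_upper : ∃ M : ℝ, ∀ x > 0, σ x ≤ M)
    (hσ_lower : ∃ m > 0, ∀ x > 0, m ≤ σ x)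
    (hσ_cont : ContinuousOn σ (Set.Ioi 0)) :
    -- (i) out-of-the-money call
    (V₀ * η S₀ ^ 2 < K →
      (∀ z : ℝ, z ∈ callDomain η S₀ K ↔ ∃ G : ℝ, SolvesCall η S₀ K z G) ∧
      ∃ Gc : ℝ → ℝ,
        (∀ z ∈ callDomain η S₀ K, SolvesCall η S₀ K z (Gc z) ∧
          ∀ G : ℝ, SolvesCall η S₀ K z G → callTerm η S₀ K z (Gc z) ≤ callTerm η S₀ K z G) ∧
        (rateFunction η σ 0 S₀ V₀ K : EReal) =
          ⨅ z ∈ callDomain η S₀ K,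
            ((callTerm η S₀ K z (Gc z) : ℝ) : EReal) + (asianRate σ V₀ z : EReal)) ∧
    -- (ii) out-of-the-money put
    (K < V₀ * η S₀ ^ 2 →
      (∀ z : ℝ, z ∈ putDomain η S₀ K ↔ ∃ G : ℝ, SolvesPut η S₀ K z G) ∧
      ∃ Gp : ℝ → ℝ,
        (∀ z ∈ putDomain η S₀ K, SolvesPut η S₀ K z (Gp z) ∧
          ∀ G : ℝ, SolvesPut η S₀ K z G → putTerm η S₀ K z (Gp z) ≤ putTerm η S₀ K z G) ∧
        (rateFunction η σ 0 S₀ V₀ K : EReal) =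
          ⨅ z ∈ putDomain η S₀ K,
            ((putTerm η S₀ K z (Gp z) : ℝ) : EReal) + (asianRate σ V₀ z : EReal)) := by

  obtain ⟨μ, hμ, hμη⟩ := hη_lower
  have hη : ∀ x > 0, 0 < η x := fun x hx => hμ.trans_le (hμη x hx)
  constructor
  · intro h0
    have hp := profile_level hS₀ (Or.inl rfl) hη_upper ⟨μ, hμ, hμη⟩ hη_anti hη_diff hη_deriv
    refine exists_optimal_price hp hS₀ hV₀ hK (Or.inl rfl) hη ?_
      (mem_callDomain_iff hS₀ hK hη) (solvesCall_iff hp hS₀ hK hη) fun z G => ?_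
    · simpa only [levelPotential, levelPrice_zero, one_mul] using h0
    · simp only [callTerm, one_mul]
  · intro h0
    have hp := profile_level hS₀ (Or.inr rfl) hη_upper ⟨μ, hμ, hμη⟩ hη_anti hη_diff hη_deriv
    refine exists_optimal_price hp hS₀ hV₀ hK (Or.inr rfl) hη ?_
      (mem_putDomain_iff hS₀ hK hη) (solvesPut_iff hp hS₀ hK hη) fun z G => ?_
    · simpa only [levelPotential, levelPrice_zero, neg_one_mul, mul_neg, neg_lt_neg_iff] using h0
    · simp only [putTerm, neg_one_mul, neg_sub]
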